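/- Let $H$ and $U$ be real Hilbert spaces with topological duals $H^*,U^*$, let $T>0$, and let $A$ be a densely defined linear operator on $H$ that generates a strongly continuous semigroup $S(t)=e^{tA}$; write $e^{tA^*}\varphi=\varphi\circ S(t)$ for $\varphi\in H^*$. Let $l_1,m\colon H\to\mathbb R$ be continuously Fréchet differentiable. Let $f\colon[0,T]\times H\to\mathcal L(U,H)$ be such that $f(\cdot,x)$ is norm-continuous on $[0,T]$ for every $x\in H$, $f(t,\cdot)$ is continuously Fréchet differentiable for every $t\in(0,T)$, and its derivative is locally bounded, uniformly in time: every $(t,x)\in[0,T]\times H$ has a neighbourhood on which $\|f_y(s,z)\|$, $s\in(0,T)$, is bounded. Let $R\colon U\to U$ be bounded, self-adjoint and coercive, $\langle Rv,v\rangle_U\ge\gamma_R\|v\|_U^2$ for all $v\in U$ with some $\gamma_R>0$. Let $\alpha_d\in\mathbb R$ and $y_0\in H$. For a control $u\colon[0,T]\to U$, a mild solution of $\dot y=Ay+f(t,y)u$, $y(0)=y_0$, is a $y\in C([0,T];H)$ with $$y(t)=S(t)y_0+\int_0^tS(t-s)f(s,y(s))u(s)\,ds,\qquad t\in[0,T],$$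 and $J_1(u)=\int_0^Tl_1(y(s))\,ds+m(y(T))$ for this $y$. Let $u_1\in C([0,T];U)$ be a reference control, let $y$ be a mild solution for $u=u_1$, and let $p\in C([0,T];H^*)$ be a corresponding mild solution of the adjoint problem, i.e. $p(T)=m_y(y(T))$ and $$p(t)=e^{(T-t)A^*}p(T)+\int_t^Te^{(s-t)A^*}\Big(\big((f(s,y(s))u_1(s))_y\big)^*p(s)+(l_1)_y(y(s))\Big)ds,\qquad t\in[0,T].$$ (The integrands are required to be Bochner integrable.) For $\tau\in(0,T)$, $v\in U$ and $\lambda>0$ let $u_{\lambda,\tau,v}$ be equal to $v$ on $[\tau-\frac\lambda2,\tau+\frac\lambda2]$ and to $u_1$ elsewhere. Then the mild solution for $u_1$ is unique and, for all $\tau\in(0,T)$ and $v\in U$, there is a unique mild solution for $u_{\lambda,\tau,v}$ for all sufficiently small $\lambda>0$, and the mode insertion gradient $$\frac{dJ_1}{d\lambda^+}(\tau,v)=\lim_{\lambda\downarrow0}\frac{J_1(u_{\lambda,\tau,v})-J_1(u_1)}{\lambda}$$ exists. For $\tau\in\{0,T\}$ the limit $\frac{dJ_1}{d\lambda^+}(\tau,v):=\lim_{\sigma\to\tau,\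 \sigma\in(0,T)}\frac{dJ_1}{d\lambda^+}(\sigma,v)$ exists as well. Define $P(t)\in U^*$ by $P(t)w=\langle f(t,y(t))^*p(t),w\rangle_{U^*,U}$ and let $P^*(t)\colon\mathbb R\to U$ be its adjoint. Then $P\in C([0,T];U^*)$; the operator $P^*(t)P(t)+R^*$ has a bounded inverse $\Pi(t)=(P^*(t)P(t)+R^*)^{-1}$ for every $t\in[0,T]$; and for every $\tau\in[0,T]$ the SAC subproblem $$\min_{v\in U}\ l_2(v)=\frac12\Big[\frac{dJ_1}{d\lambda^+}(\tau,v)-\alpha_d\Big]^2+\frac12\langle v,Rv\rangle_U$$ has exactly one minimiser, namely $$u^*(\tau)=\Pi(\tau)\big[P^*(\tau)P(\tau)u_1(\tau)+P^*(\tau)\alpha_d\big].$$ -/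

import Mathlib

open Set Filter Topology MeasureTheory

/-- A strongly continuous (C₀-) semigroup `(S t)_{t ≥ 0}` of bounded operators on `H`.
Only the values at `t ≥ 0` are meaningful. -/
structure C0Semigroup (H : Type*) [NormedAddCommGroup H] [InnerProductSpace ℝ H] where
  toFun : ℝ → H →L[ℝ] H
  map_zero : toFun 0 = ContinuousLinearMap.id ℝ H
  map_add : ∀ s t : ℝ, 0 ≤ s → 0 ≤ t → toFun (s + t) = (toFun s).comp (toFun t)
  continuousOn : ∀ x : H, ContinuousOn (fun t => toFun t x) (Ici 0)

namespace SAC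

variable {H U : Type*} [NormedAddCommGroup H] [InnerProductSpace ℝ H]
  [NormedAddCommGroup U] [InnerProductSpace ℝ U]

/-- The (possibly unbounded) operator `A` is the infinitesimal generator of `S`: its domain consists
of all `x` for which `(S h x - x) / h` converges as `h ↓ 0`, and `A x` is that limit. -/
def IsGenerator (S : C0Semigroup H) (A : H →ₗ.[ℝ] H) : Prop :=
  ∀ x z : H, (x, z) ∈ A.graph ↔
    Tendsto (fun h : ℝ => h⁻¹ • (S.toFun h x - x)) (𝓝[>] 0) (𝓝 z)

/-- `y ∈ C([0,T]; H)` is a mild solution of `ẏ = A y + f(t, y) u`, `y(0) = y₀`, where `A`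
generates `S`. -/
def IsMildSolution (S : C0Semigroup H) (f : ℝ → H → U →L[ℝ] H) (y₀ : H) (T : ℝ)
    (u : ℝ → U) (y : ℝ → H) : Prop :=
  ContinuousOn y (Icc 0 T) ∧
  ∀ t ∈ Icc 0 T,
    IntervalIntegrable (fun s => S.toFun (t - s) (f s (y s) (u s))) volume 0 t ∧
    y t = S.toFun t y₀ + ∫ s in (0 : ℝ)..t, S.toFun (t - s) (f s (y s) (u s))

/-- Existence and uniqueness (on `[0,T]`) of the mild solution for the control `u`. -/
def HasUniqueState (S : C0Semigroup H) (f : ℝ → H → U →L[ℝ] H) (y₀ : H) (T : ℝ)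
    (u : ℝ → U) : Prop :=
  ∃ y, IsMildSolution S f y₀ T u y ∧
    ∀ z, IsMildSolution S f y₀ T u z → EqOn z y (Icc 0 T)

/-- The integrand `((f(s,y(s)) u(s))_y)^* p(s) + (l₁)_y(y(s))` of the adjoint equation, without the
semigroup factor, as an element of `H^*`. -/
noncomputable def adjointSource (f : ℝ → H → U →L[ℝ] H) (l₁ : H → ℝ)
    (u : ℝ → U) (y : ℝ → H) (p : ℝ → StrongDual ℝ H) (s : ℝ) : StrongDual ℝ H :=
  (p s).comp (fderiv ℝ (fun x => f s x (u s)) (y s)) + fderiv ℝ l₁ (y s)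

/-- `p ∈ C([0,T]; H^*)` is a mild solution of the adjoint problem
`ṗ = -A^* p - ((f(t,y) u)_y)^* p - (l₁)_y(y)`, `p(T) = m_y(y(T))`. The operator `e^{tA^*}` on `H^*`
is the dual operator `φ ↦ φ ∘ S t`. -/
def IsMildAdjoint (S : C0Semigroup H) (f : ℝ → H → U →L[ℝ] H) (l₁ m : H → ℝ) (T : ℝ)
    (u : ℝ → U) (y : ℝ → H) (p : ℝ → StrongDual ℝ H) : Prop :=
  ContinuousOn p (Icc 0 T) ∧
  p T = fderiv ℝ m (y T) ∧
  ∀ t ∈ Icc 0 T,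
    IntervalIntegrable
      (fun s => (adjointSource f l₁ u y p s).comp (S.toFun (s - t))) volume t T ∧
    p t = (p T).comp (S.toFun (T - t)) +
      ∫ s in t..T, (adjointSource f l₁ u y p s).comp (S.toFun (s - t))

open Classical in
/-- The stage cost `J₁(u) = ∫₀ᵀ l₁(y(s)) ds + m(y(T))`, where `y` is the mild solution of the state
equation for the control `u` (it is set to `0` if there is no such solution). -/
noncomputable def stageCost (S : C0Semigroup H) (f : ℝ → H → U →L[ℝ] H) (l₁ m : H → ℝ) (y₀ : H)
    (T : ℝ) (u : ℝ → U) : ℝ :=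
  if h : ∃ y, IsMildSolution S f y₀ T u y then
    (∫ s in (0 : ℝ)..T, l₁ (h.choose s)) + m (h.choose T)
  else 0

open Classical in
/-- The needle variation of `u₁` with value `v` on `[τ - lam/2, τ + lam/2]`. -/
noncomputable def needle (u₁ : ℝ → U) (lam τ : ℝ) (v : U) : ℝ → U :=
  fun t => if t ∈ Icc (τ - lam / 2) (τ + lam / 2) then v else u₁ t

/-- For an application time `τ ∈ (0,T)`: the mode insertion gradient, i.e. the limit of
`(J₁(u_{lam,τ,v}) - J₁(u₁)) / lam` as `lam ↓ 0`, exists and equals `g`. -/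
def HasModeInsertionGradient (S : C0Semigroup H) (f : ℝ → H → U →L[ℝ] H) (l₁ m : H → ℝ) (y₀ : H)
    (T : ℝ) (u₁ : ℝ → U) (τ : ℝ) (v : U) (g : ℝ) : Prop :=
  Tendsto
    (fun lam : ℝ =>
      (stageCost S f l₁ m y₀ T (needle u₁ lam τ v) - stageCost S f l₁ m y₀ T u₁) / lam)
    (𝓝[>] 0) (𝓝 g)

/-- The sensitivity `dJ₁/dlam⁺(τ, v)` on the closed interval `[0,T]`: the mode insertion gradient for
`τ ∈ (0,T)`, and its limit from inside the interval for `τ = 0` and `τ = T`, where the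
needle interval would stick out of `[0,T]`. -/
def HasSensitivity (S : C0Semigroup H) (f : ℝ → H → U →L[ℝ] H) (l₁ m : H → ℝ) (y₀ : H)
    (T : ℝ) (u₁ : ℝ → U) (τ : ℝ) (v : U) (g : ℝ) : Prop :=
  (τ ∈ Ioo 0 T ∧ HasModeInsertionGradient S f l₁ m y₀ T u₁ τ v g) ∨
  ((τ = 0 ∨ τ = T) ∧ ∃ d : ℝ → ℝ,
    (∀ σ ∈ Ioo 0 T, HasModeInsertionGradient S f l₁ m y₀ T u₁ σ v (d σ)) ∧
    Tendsto d (𝓝[Ioo 0 T] τ) (𝓝 g))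

/-- The objective `l₂(v) = ½ (dJ(v) - α)² + ½ ⟨v, R v⟩` of the SAC subproblem, where `dJ v` is the
sensitivity for the value `v`. -/
noncomputable def l₂ (dJ : U → ℝ) (α : ℝ) (R : U →L[ℝ] U) (v : U) : ℝ :=
  1 / 2 * (dJ v - α) ^ 2 + 1 / 2 * inner ℝ v (R v)

/-- `P(t) w = ⟨f(t,y(t))^* p(t), w⟩`, as an element of `U^*`. -/
noncomputable def P (f : ℝ → H → U →L[ℝ] H) (y : ℝ → H) (p : ℝ → StrongDual ℝ H) (t : ℝ) :
    StrongDual ℝ U :=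
  (p t).comp (f t (y t))

/-- The operator `P(t)^* P(t) + R^*` on `U`, with Hilbert space adjoints. -/
noncomputable def gram [CompleteSpace U] (f : ℝ → H → U →L[ℝ] H) (y : ℝ → H)
    (p : ℝ → StrongDual ℝ H) (R : U →L[ℝ] U) (t : ℝ) : U →L[ℝ] U :=
  (ContinuousLinearMap.adjoint (P f y p t)).comp (P f y p t) + ContinuousLinearMap.adjoint R

/-- `Π(t) = (P(t)^* P(t) + R^*)⁻¹`. -/
noncomputable def Pi [CompleteSpace U] (f : ℝ → H → U →L[ℝ] H) (y : ℝ → H)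
    (p : ℝ → StrongDual ℝ H) (R : U →L[ℝ] U) (t : ℝ) : U →L[ℝ] U :=
  (gram f y p R t).inverse

/-- The SAC control value `Π(τ) [P(τ)^* P(τ) u₁(τ) + P(τ)^* α]`. -/
noncomputable def control [CompleteSpace U] (f : ℝ → H → U →L[ℝ] H) (y : ℝ → H)
    (p : ℝ → StrongDual ℝ H) (R : U →L[ℝ] U) (u₁ : ℝ → U) (α : ℝ) (τ : ℝ) : U :=
  Pi f y p R τ
    (ContinuousLinearMap.adjoint (P f y p τ) (P f y p τ (u₁ τ)) +
      ContinuousLinearMap.adjoint (P f y p τ) α)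

end SAC

/-! The mode insertion gradient is the affine function `P(τ)(v - u₁(τ))` of `v`. Given this, `l₂` is
a quadratic with Hessian `gram ≥ γ`, and completing the square at the solution of the normal
equation gives the unique minimiser.

To find the gradient, let `y + w` be the state for a needle of width `lam`. The needle forces the
equation for `w` by a term of integral `O(lam)`, so Grönwall gives `w = O(lam)` uniformly on
`[0,T]`. No linearised state equation is needed: with the Hamiltonian `⟨p, f(s,z)u₁⟩ + l₁(z)`, whose
state derivative along `y` is the adjoint source, the cost increment has an exact expansion
(`cost_sub_eq`). Fubini and the mild adjoint equation (`integral_apply_conv_eq`) cancel all terms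
linear in `w`. What remains is the Taylor remainders of the Hamiltonian and of `m`, both `o(lam)`,
and the integral of `⟨p, f(s,y+w)(v - u₁)⟩` over the needle, whose average tends to `P(τ)(v -
u₁(τ))`.

The perturbed state comes from a fixed point after truncating `w` to a tube around `y`, where `f` is
uniformly Lipschitz; the bound `O(lam)` then shows that the truncation is inactive
(`exists_needle_perturbation`). The derivative of `f` is not assumed continuous in time, so the
estimates use only local Lipschitz bounds, and measurability comes from difference quotients. -/

/-! ### Measurability and Grönwall. -/

/-- A strongly measurable family of operators applied to a strongly measurable function. -/
theorem MeasureTheory.AEStronglyMeasurable.apply_of_pointwise {X E F : Type*} [MeasurableSpace X]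
    [NormedAddCommGroup E] [NormedSpace ℝ E] [NormedAddCommGroup F] [NormedSpace ℝ F]
    {μ : Measure X} {A : X → E →L[ℝ] F} {g : X → E}
    (hA : ∀ h : E, AEStronglyMeasurable (fun x => A x h) μ) (hg : AEStronglyMeasurable g μ) :
    AEStronglyMeasurable (fun x => A x (g x)) μ := by
  obtain ⟨g', hg', hgg'⟩ := hg
  have key : AEStronglyMeasurable (fun x => A x (g' x)) μ := by
    refine aestronglyMeasurable_of_tendsto_ae (u := atTop)
      (f := fun n x => A x (hg'.approx n x)) (fun n => ?_)
      (Eventually.of_forall fun x => ((A x).continuous.tendsto _).comp (hg'.tendsto_approx x))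
    set φ := hg'.approx n
    have : (fun x => A x (φ x)) =
        fun x => ∑ c ∈ φ.range, (φ ⁻¹' {c}).indicator (fun x => A x c) x := by
      funext x
      rw [Finset.sum_eq_single (φ x)]
      · simp
      · intro c _ hc
        exact indicator_of_notMem (fun h => hc (by simpa using h.symm)) _
      · intro h
        exact absurd (φ.mem_range_self x) h
    rw [this]
    exact Finset.aestronglyMeasurable_fun_sum _
      fun c _ => (hA c).indicator (φ.measurableSet_fiber c)
  exact key.congr (hgg'.mono fun x hx => by simp only [hx])

/-- Grönwall's inequality in integral form. -/
theorem le_mul_exp_of_le_add_integral {T a b : ℝ} {φ : ℝ → ℝ} (ha : 0 ≤ a) (hb : 0 ≤ b)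
    (hφ : ContinuousOn φ (Icc 0 T)) (hφ0 : ∀ t ∈ Icc 0 T, 0 ≤ φ t)
    (h : ∀ t ∈ Icc 0 T, φ t ≤ a + b * ∫ s in (0 : ℝ)..t, φ s) :
    ∀ t ∈ Icc 0 T, φ t ≤ a * Real.exp (b * T) := by
  intro t ht
  have hT : (0 : ℝ) ≤ T := ht.1.trans ht.2
  -- The constant extension beyond `[0,T]` is continuous on the whole line, so its primitive has a
  -- two-sided derivative everywhere.
  set ψ : ℝ → ℝ := IccExtend hT ((Icc 0 T).domRestrict φ)
  have hψ : Continuous ψ := (continuousOn_iff_continuous_domRestrict.1 hφ).Icc_extend'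
  have hψφ : ∀ s ∈ Icc 0 T, ψ s = φ s := fun s hs => IccExtend_of_mem hT _ hs
  have hint : ∀ s ∈ Icc 0 T, ∫ r in (0 : ℝ)..s, φ r = ∫ r in (0 : ℝ)..s, ψ r := by
    intro s hs
    refine intervalIntegral.integral_congr fun r hr => (hψφ r ?_).symm
    rw [uIcc_of_le hs.1] at hr
    exact ⟨hr.1, hr.2.trans hs.2⟩
  have hder : ∀ s, HasDerivAt (fun s => ∫ r in (0 : ℝ)..s, ψ r) (ψ s) s :=
    fun s => intervalIntegral.integral_hasDerivAt_right (hψ.intervalIntegrable _ _)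
      (hψ.stronglyMeasurableAtFilter _ _) hψ.continuousAt
  have hnn : ∀ s ∈ Icc 0 T, 0 ≤ ∫ r in (0 : ℝ)..s, ψ r := by
    intro s hs
    refine intervalIntegral.integral_nonneg hs.1 fun r hr => ?_
    have hr' : r ∈ Icc 0 T := ⟨hr.1, hr.2.trans hs.2⟩
    rw [hψφ r hr']
    exact hφ0 r hr'
  -- The differential Grönwall inequality is applied to the primitive of `φ`; the bound is then put
  -- back into the hypothesis.
  have key := norm_le_gronwallBound_of_norm_deriv_right_le
    (f := fun s => ∫ r in (0 : ℝ)..s, ψ r) (f' := ψ) (δ := 0) (K := b) (ε := a) (a := 0) (b := T)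
    (fun s _ => (hder s).continuousAt.continuousWithinAt)
    (fun s _ => (hder s).hasDerivWithinAt) (by simp) (fun s hs => by
      have hs' := Ico_subset_Icc_self hs
      rw [Real.norm_of_nonneg (hnn s hs'), hψφ s hs', Real.norm_of_nonneg (hφ0 s hs'),
        ← hint s hs', add_comm]
      exact h s hs') t ht
  rw [Real.norm_of_nonneg (hnn t ht), ← hint t ht, sub_zero] at key
  have h1 : φ t ≤ a * Real.exp (b * t) := by
    rcases eq_or_ne b 0 with rfl | hb0
    · simpa using h t ht
    · rw [gronwallBound_of_K_ne_0 hb0] at key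
      refine (h t ht).trans ((add_le_add_right (mul_le_mul_of_nonneg_left key hb) a).trans_eq ?_)
      field_simp
      ring
  refine h1.trans (mul_le_mul_of_nonneg_left (Real.exp_le_exp.2 ?_) ha)
  exact mul_le_mul_of_nonneg_left ht.2 hb

/-! ### Convolution with a strongly continuous semigroup. -/

namespace C0Semigroup

variable {H : Type*} [NormedAddCommGroup H] [InnerProductSpace ℝ H]

/-- The semigroup, extended to negative times by the identity. -/
def extend (S : C0Semigroup H) (t : ℝ) : H →L[ℝ] H := S.toFun (max t 0)

theorem extend_of_nonneg (S : C0Semigroup H) {t : ℝ} (ht : 0 ≤ t) : S.extend t = S.toFun t := by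
  rw [extend, max_eq_left ht]

theorem continuous_extend_apply (S : C0Semigroup H) (x : H) : Continuous fun t => S.extend t x :=
  (S.continuousOn x).comp_continuous (continuous_id.max continuous_const) fun _ =>
    mem_Ici.2 (le_max_right _ _)

/-- Orbits are bounded on compact time intervals, so Banach–Steinhaus applies; negative times only
contribute the identity. -/
theorem exists_norm_le [CompleteSpace H] (S : C0Semigroup H) (T : ℝ) :
    ∃ M, 0 ≤ M ∧ ∀ t ≤ T, ‖S.extend t‖ ≤ M := by
  obtain ⟨C, hC⟩ := banach_steinhaus (g := fun t : Icc (0 : ℝ) (max T 0) => S.toFun t) fun x => by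
    obtain ⟨C, hC⟩ := isCompact_Icc.exists_bound_of_continuousOn
      ((S.continuousOn x).mono (Icc_subset_Ici_self : Icc (0 : ℝ) (max T 0) ⊆ _))
    exact ⟨C, fun t => hC t t.2⟩
  have h0 : (0 : ℝ) ∈ Icc 0 (max T 0) := ⟨le_rfl, le_max_right _ _⟩
  refine ⟨C, (norm_nonneg _).trans (hC ⟨0, h0⟩), fun t ht => ?_⟩
  exact hC ⟨max t 0, le_max_right _ _, max_le_max_right 0 ht⟩

/-- The convolution `∫₀ᵗ S(t - s) G(s) ds`. -/
noncomputable def conv (S : C0Semigroup H) (G : ℝ → H) (t : ℝ) : H :=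
  ∫ s in (0 : ℝ)..t, S.toFun (t - s) (G s)

variable {S : C0Semigroup H} {T t M C : ℝ} {G : ℝ → H}

theorem conv_eq (ht : 0 ≤ t) : S.conv G t = ∫ s in (0 : ℝ)..t, S.extend (t - s) (G s) := by
  refine intervalIntegral.integral_congr fun s hs => ?_
  rw [uIcc_of_le ht] at hs
  simp only [S.extend_of_nonneg (sub_nonneg.2 hs.2)]

theorem aestronglyMeasurable_extend_apply {μ : Measure ℝ} (t : ℝ) (hG : AEStronglyMeasurable G μ) :
    AEStronglyMeasurable (fun s => S.extend (t - s) (G s)) μ :=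
  AEStronglyMeasurable.apply_of_pointwise
    (fun h => ((S.continuous_extend_apply h).comp (continuous_const.sub continuous_id)
      ).aestronglyMeasurable) hG

theorem intervalIntegrable_extend (hM : ∀ t ≤ T, ‖S.extend t‖ ≤ M)
    (hG : AEStronglyMeasurable G (volume.restrict (Icc 0 T)))
    (hC : ∀ s ∈ Icc 0 T, ‖G s‖ ≤ C) (ht : t ∈ Icc 0 T) :
    IntervalIntegrable (fun s => S.extend (t - s) (G s)) volume 0 t := by
  rw [intervalIntegrable_iff_integrableOn_Icc_of_le ht.1]
  refine (integrable_const (M * C)).mono'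
    (aestronglyMeasurable_extend_apply t (hG.mono_set (Icc_subset_Icc_right ht.2))) ?_
  refine (ae_restrict_iff' measurableSet_Icc).2 (Eventually.of_forall fun s hs => ?_)
  exact (S.extend (t - s)).le_of_opNorm_le_of_le (hM _ (by linarith [hs.1, ht.2]))
    (hC s ⟨hs.1, hs.2.trans ht.2⟩)

theorem intervalIntegrable_conv (hM : ∀ t ≤ T, ‖S.extend t‖ ≤ M)
    (hG : AEStronglyMeasurable G (volume.restrict (Icc 0 T)))
    (hC : ∀ s ∈ Icc 0 T, ‖G s‖ ≤ C) (ht : t ∈ Icc 0 T) :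
    IntervalIntegrable (fun s => S.toFun (t - s) (G s)) volume 0 t := by
  refine (intervalIntegrable_extend hM hG hC ht).congr fun s hs => ?_
  rw [uIoc_of_le ht.1] at hs
  simp only [S.extend_of_nonneg (sub_nonneg.2 hs.2)]

/-- Written over the fixed interval `[0,T]` with the indicator of `s < t`, the integrand is
continuous in `t` except at `s = t`, a null set, and dominated convergence applies. -/
theorem continuousOn_conv (hM : ∀ t ≤ T, ‖S.extend t‖ ≤ M)
    (hG : AEStronglyMeasurable G (volume.restrict (Icc 0 T)))
    (hC : ∀ s ∈ Icc 0 T, ‖G s‖ ≤ C) : ContinuousOn (S.conv G) (Icc 0 T) := by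
  have h1 : ∀ t ∈ Icc 0 T, S.conv G t =
      ∫ s in Icc 0 T, (Iio t).indicator (fun s => S.extend (t - s) (G s)) s := by
    intro t ht
    rw [conv_eq ht.1, intervalIntegral.integral_of_le ht.1, integral_Ioc_eq_integral_Ioo,
      setIntegral_indicator measurableSet_Iio, ← integral_Ico_eq_integral_Ioo]
    congr 2
    ext s
    exact ⟨fun h => ⟨⟨h.1, h.2.le.trans ht.2⟩, h.2⟩, fun h => ⟨h.1.1, h.2⟩⟩
  refine ContinuousOn.congr (fun t ht => ?_) h1
  refine continuousWithinAt_of_dominated (bound := fun _ => M * C) ?_ ?_ (integrable_const _) ?_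
  · exact Eventually.of_forall fun t =>
      (aestronglyMeasurable_extend_apply t hG).indicator measurableSet_Iio
  · filter_upwards [self_mem_nhdsWithin] with t ht
    refine (ae_restrict_iff' measurableSet_Icc).2 (Eventually.of_forall fun s hs => ?_)
    refine (norm_indicator_le_norm_self _ _).trans ?_
    exact (S.extend (t - s)).le_of_opNorm_le_of_le (hM _ (by linarith [hs.1, ht.2])) (hC s hs)
  · refine ae_restrict_of_ae ?_
    filter_upwards [compl_mem_ae_iff.2 (measure_singleton t)] with s hs
    have hc : Continuous fun x : ℝ => S.extend (x - s) (G s) :=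
      (S.continuous_extend_apply _).comp (continuous_id.sub continuous_const)
    rcases lt_or_gt_of_ne (show s ≠ t from hs) with h | h
    · refine (hc.continuousWithinAt).congr_of_eventuallyEq ?_ ?_
      · filter_upwards [mem_nhdsWithin_of_mem_nhds (Ioi_mem_nhds h)] with x hx
        exact indicator_of_mem (show s ∈ Iio x from hx) _
      · exact indicator_of_mem (show s ∈ Iio t from h) _
    · refine (continuousWithinAt_const (b := (0 : H))).congr_of_eventuallyEq ?_ ?_
      · filter_upwards [mem_nhdsWithin_of_mem_nhds (Iio_mem_nhds h)] with x hx
        exact indicator_of_notMem (show s ∉ Iio x from fun h' => lt_asymm (mem_Iio.1 h') (mem_Iio.1 hx)) _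
      · exact indicator_of_notMem (show s ∉ Iio t from fun h' => lt_asymm (mem_Iio.1 h') h) _

theorem norm_conv_le (hM : ∀ t ≤ T, ‖S.extend t‖ ≤ M) (ht : t ∈ Icc 0 T)
    {g : ℝ → ℝ} (hg : IntervalIntegrable g volume 0 t) (hC : ∀ s ∈ Icc 0 t, ‖G s‖ ≤ g s) :
    ‖S.conv G t‖ ≤ M * ∫ s in (0 : ℝ)..t, g s := by
  rw [conv_eq ht.1, ← intervalIntegral.integral_const_mul]
  refine intervalIntegral.norm_integral_le_of_norm_le ht.1
    (Eventually.of_forall fun s hs => ?_) (hg.const_mul M)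
  exact (S.extend (t - s)).le_of_opNorm_le_of_le (hM _ (by linarith [hs.1, ht.2]))
    (hC s ⟨hs.1.le, hs.2⟩)

end C0Semigroup

/-! ### The integrated semilinear equation: existence and a priori bound. -/

namespace C0Semigroup

variable {H : Type*} [NormedAddCommGroup H] [InnerProductSpace ℝ H]
variable {S : C0Semigroup H} {T t M C : ℝ} {G : ℝ → H}

theorem conv_sub {G₁ G₂ : ℝ → H}
    (h₁ : IntervalIntegrable (fun s => S.toFun (t - s) (G₁ s)) volume 0 t)
    (h₂ : IntervalIntegrable (fun s => S.toFun (t - s) (G₂ s)) volume 0 t) :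
    S.conv G₁ t - S.conv G₂ t = S.conv (fun s => G₁ s - G₂ s) t := by
  simp only [conv, map_sub]
  exact (intervalIntegral.integral_sub h₁ h₂).symm

/-- The integrated semilinear equation with a bounded, globally Lipschitz right-hand side has a
solution. -/
theorem exists_eq_conv [CompleteSpace H] {L : ℝ} (hT : 0 ≤ T) (hL : 0 ≤ L) {F : ℝ → H → H}
    (hmeas : ∀ w : ℝ → H, ContinuousOn w (Icc 0 T) →
      AEStronglyMeasurable (fun s => F s (w s)) (volume.restrict (Icc 0 T)))
    (hlip : ∀ s ∈ Icc 0 T, ∀ x y, ‖F s x - F s y‖ ≤ L * ‖x - y‖)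
    (hbd : ∀ s ∈ Icc 0 T, ∀ x, ‖F s x‖ ≤ C) :
    ∃ w : ℝ → H, ContinuousOn w (Icc 0 T) ∧
      ∀ t ∈ Icc 0 T, w t = S.conv (fun s => F s (w s)) t := by
  obtain ⟨M, hM0, hM⟩ := S.exists_norm_le T
  -- Any `k > M * L` makes the contraction constant `M * L / k` smaller than one, on an interval of
  -- any length.
  set k : ℝ := M * L + 1 with hk
  have hML : 0 ≤ M * L := mul_nonneg hM0 hL
  have hk0 : 0 < k := by linarith
  -- The substitution `w = exp(k t) ζ` turns Bielecki's weighted norm into the plain supremum norm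
  -- of `ζ`.
  let W : C(Icc (0 : ℝ) T, H) → ℝ → H := fun ζ t => Real.exp (k * t) • ζ (projIcc 0 T hT t)
  have hW : ∀ ζ, Continuous (W ζ) := fun ζ =>
    (Real.continuous_exp.comp (continuous_const.mul continuous_id)).smul
      (ζ.continuous.comp continuous_projIcc)
  have hm : ∀ ζ, AEStronglyMeasurable (fun s => F s (W ζ s)) (volume.restrict (Icc 0 T)) :=
    fun ζ => hmeas _ (hW ζ).continuousOn
  have hconv : ∀ ζ, ContinuousOn (S.conv fun s => F s (W ζ s)) (Icc 0 T) := fun ζ =>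
    continuousOn_conv hM (hm ζ) (fun s hs => hbd s hs _)
  have hexp : Continuous fun t : ℝ => Real.exp (-(k * t)) :=
    Real.continuous_exp.comp (continuous_const.mul continuous_id).neg
  let Ψ : C(Icc (0 : ℝ) T, H) → C(Icc (0 : ℝ) T, H) := fun ζ =>
    ⟨(Icc 0 T).domRestrict fun t => Real.exp (-(k * t)) • S.conv (fun s => F s (W ζ s)) t,
      continuousOn_iff_continuous_domRestrict.1 (hexp.continuousOn.smul (hconv ζ))⟩
  have hK0 : 0 ≤ M * L / k := div_nonneg hML hk0.le
  have hcontr : ContractingWith ⟨M * L / k, hK0⟩ Ψ := by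
    refine ⟨NNReal.coe_lt_coe.1 ((div_lt_one hk0).2 (by linarith)),
      LipschitzWith.of_dist_le_mul fun ζ η => ?_⟩
    refine (ContinuousMap.dist_le (mul_nonneg hK0 dist_nonneg)).2 fun t => ?_
    obtain ⟨t, ht⟩ := t
    change dist (Real.exp (-(k * t)) • S.conv (fun s => F s (W ζ s)) t)
      (Real.exp (-(k * t)) • S.conv (fun s => F s (W η s)) t) ≤ M * L / k * dist ζ η
    rw [dist_eq_norm, ← smul_sub, norm_smul, Real.norm_of_nonneg (Real.exp_pos _).le,
      conv_sub (intervalIntegrable_conv hM (hm ζ) (fun s hs => hbd s hs _) ht)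
        (intervalIntegrable_conv hM (hm η) (fun s hs => hbd s hs _) ht)]
    have hest : ‖S.conv (fun s => F s (W ζ s) - F s (W η s)) t‖ ≤
        M * ∫ s in (0 : ℝ)..t, L * dist ζ η * Real.exp (k * s) := by
      refine norm_conv_le hM ht (Continuous.intervalIntegrable (by fun_prop) _ _) fun s hs => ?_
      refine (hlip s ⟨hs.1, hs.2.trans ht.2⟩ _ _).trans ?_
      rw [mul_assoc]
      refine mul_le_mul_of_nonneg_left ?_ hL
      rw [← smul_sub, norm_smul, Real.norm_of_nonneg (Real.exp_pos _).le, mul_comm, ← dist_eq_norm]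
      exact mul_le_mul_of_nonneg_right (ContinuousMap.dist_apply_le_dist _) (Real.exp_pos _).le
    have hI : ∫ s in (0 : ℝ)..t, Real.exp (k * s) = (Real.exp (k * t) - 1) / k := by
      rw [intervalIntegral.integral_comp_mul_left _ hk0.ne', integral_exp]
      simp [div_eq_inv_mul]
    rw [intervalIntegral.integral_const_mul, hI] at hest
    refine (mul_le_mul_of_nonneg_left hest (Real.exp_pos _).le).trans ?_
    have h1 : Real.exp (-(k * t)) * (Real.exp (k * t) - 1) ≤ 1 := by
      rw [mul_sub, ← Real.exp_add]
      simp [(Real.exp_pos _).le]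
    calc Real.exp (-(k * t)) * (M * (L * dist ζ η * ((Real.exp (k * t) - 1) / k)))
        = M * L / k * dist ζ η * (Real.exp (-(k * t)) * (Real.exp (k * t) - 1)) := by ring
      _ ≤ M * L / k * dist ζ η * 1 :=
        mul_le_mul_of_nonneg_left h1 (mul_nonneg hK0 dist_nonneg)
      _ = _ := mul_one _
  set ζ := ContractingWith.fixedPoint Ψ hcontr
  have hζ : Ψ ζ = ζ := hcontr.fixedPoint_isFixedPt
  refine ⟨W ζ, (hW ζ).continuousOn, fun t ht => ?_⟩
  have h2 : ζ (projIcc 0 T hT t) = Real.exp (-(k * t)) • S.conv (fun s => F s (W ζ s)) t := by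
    conv_lhs => rw [← hζ, projIcc_of_mem hT ht]
    rfl
  change Real.exp (k * t) • ζ (projIcc 0 T hT t) = _
  rw [h2, smul_smul, ← Real.exp_add, add_neg_cancel, Real.exp_zero, one_smul]

/-- A priori bound for the integrated semilinear equation. -/
theorem norm_le_of_eq_conv {a L : ℝ} {g : ℝ → ℝ} {w : ℝ → H}
    (hM0 : 0 ≤ M) (hM : ∀ t ≤ T, ‖S.extend t‖ ≤ M) (hL : 0 ≤ L)
    (hw : ContinuousOn w (Icc 0 T)) (hg : ∀ t ∈ Icc 0 T, IntervalIntegrable g volume 0 t)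
    (ha : ∀ t ∈ Icc 0 T, ∫ s in (0 : ℝ)..t, g s ≤ a) (ha0 : 0 ≤ a)
    (hG : ∀ s ∈ Icc 0 T, ‖G s‖ ≤ g s + L * ‖w s‖)
    (h : ∀ t ∈ Icc 0 T, w t = S.conv G t) :
    ∀ t ∈ Icc 0 T, ‖w t‖ ≤ M * a * Real.exp (M * L * T) := by
  refine le_mul_exp_of_le_add_integral (mul_nonneg hM0 ha0) (mul_nonneg hM0 hL) hw.norm
    (fun _ _ => norm_nonneg _) fun t ht => ?_
  have hwi : IntervalIntegrable (fun s => L * ‖w s‖) volume 0 t :=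
    (ContinuousOn.intervalIntegrable_of_Icc ht.1
      (hw.norm.mono (Icc_subset_Icc_right ht.2))).const_mul L
  rw [h t ht]
  refine (norm_conv_le hM ht ((hg t ht).add hwi)
    fun s hs => hG s ⟨hs.1, hs.2.trans ht.2⟩).trans ?_
  rw [intervalIntegral.integral_add (hg t ht) hwi, intervalIntegral.integral_const_mul, mul_add,
    mul_assoc]
  exact add_le_add_left (mul_le_mul_of_nonneg_left (ha t ht) hM0) _

end C0Semigroup

/-! ### Truncation to a ball. -/

section RadialRetraction

variable {H : Type*} [NormedAddCommGroup H] [NormedSpace ℝ H]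

/-- The radial retraction onto the closed ball of radius `r` around `0`. -/
noncomputable def radialRetraction (r : ℝ) (w : H) : H := (r / max r ‖w‖) • w

theorem radialRetraction_of_norm_le {r : ℝ} (hr : 0 < r) {w : H} (hw : ‖w‖ ≤ r) :
    radialRetraction r w = w := by
  rw [radialRetraction, max_eq_left hw, div_self hr.ne', one_smul]

theorem norm_radialRetraction_le {r : ℝ} (hr : 0 < r) (w : H) : ‖radialRetraction r w‖ ≤ r := by
  have h : 0 < max r ‖w‖ := lt_max_of_lt_left hr
  rw [radialRetraction, norm_smul, Real.norm_of_nonneg (div_nonneg hr.le h.le), div_mul_eq_mul_div,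
    div_le_iff₀ h]
  exact mul_le_mul_of_nonneg_left (le_max_right _ _) hr.le

/-- One `‖v - w‖` comes from moving the vector at a fixed scaling factor, the other from the change
of the factor, which is controlled by the difference of the norms. -/
theorem norm_radialRetraction_sub_le {r : ℝ} (hr : 0 < r) (v w : H) :
    ‖radialRetraction r v - radialRetraction r w‖ ≤ 2 * ‖v - w‖ := by
  have hv : 0 < max r ‖v‖ := lt_max_of_lt_left hr
  have hw : 0 < max r ‖w‖ := lt_max_of_lt_left hr
  have e : radialRetraction r v - radialRetraction r w =
      (r / max r ‖v‖) • (v - w) + (r / max r ‖v‖ - r / max r ‖w‖) • w := by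
    simp only [radialRetraction, smul_sub, sub_smul]
    abel
  rw [e, two_mul]
  refine (norm_add_le _ _).trans (add_le_add ?_ ?_)
  · rw [norm_smul, Real.norm_of_nonneg (div_nonneg hr.le hv.le)]
    exact mul_le_of_le_one_left (norm_nonneg _) ((div_le_one hv).2 (le_max_left _ _))
  · have h1 : r / max r ‖v‖ - r / max r ‖w‖ =
        r / max r ‖v‖ * ((max r ‖w‖ - max r ‖v‖) / max r ‖w‖) := by
      field_simp
    have h2 : |max r ‖w‖ - max r ‖v‖| ≤ ‖v - w‖ := by
      rw [max_comm r, max_comm r, norm_sub_rev]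
      exact (abs_max_sub_max_le_abs _ _ _).trans (abs_norm_sub_norm_le _ _)
    rw [norm_smul, h1, norm_mul, Real.norm_of_nonneg (div_nonneg hr.le hv.le), norm_div,
      Real.norm_of_nonneg hw.le, Real.norm_eq_abs, mul_assoc, div_mul_eq_mul_div |max r ‖w‖ - _|]
    refine (mul_le_of_le_one_left (by positivity) ((div_le_one hv).2 (le_max_left _ _))).trans ?_
    rw [div_le_iff₀ hw]
    exact mul_le_mul h2 (le_max_right _ _) (norm_nonneg _) (norm_nonneg _)

theorem continuous_radialRetraction {r : ℝ} (hr : 0 < r) :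
    Continuous (radialRetraction r : H → H) :=
  LipschitzWith.continuous (K := 2) <| LipschitzWith.of_dist_le_mul fun v w => by
    simpa [dist_eq_norm] using norm_radialRetraction_sub_le hr v w

end RadialRetraction

/-! ### Families that are locally Lipschitz in the state. -/

section LocallyLipschitzFamily

variable {H E F : Type*} [NormedAddCommGroup H] [NormedAddCommGroup E] [NormedAddCommGroup F]
variable {T : ℝ} {g : ℝ → H → E}

/-- The maps `g s`, `s ∈ [0,T]`, are locally Lipschitz, locally uniformly in time. -/
def LocallyLipschitzFamily (T : ℝ) (g : ℝ → H → E) : Prop :=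
  ∀ t ∈ Icc 0 T, ∀ x : H, ∃ L r : ℝ, 0 < r ∧ ∀ s ∈ Icc 0 T, |s - t| < r →
    ∀ z ∈ Metric.ball x r, ∀ z' ∈ Metric.ball x r, ‖g s z - g s z'‖ ≤ L * ‖z - z'‖

namespace LocallyLipschitzFamily

theorem of_le {h : ℝ → H → F} {C : ℝ} (hg : LocallyLipschitzFamily T g) (hC : 0 ≤ C)
    (hle : ∀ s ∈ Icc 0 T, ∀ z z', ‖h s z - h s z'‖ ≤ C * ‖g s z - g s z'‖) :
    LocallyLipschitzFamily T h := by
  intro t ht x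
  obtain ⟨L, r, hr, hL⟩ := hg t ht x
  refine ⟨C * L, r, hr, fun s hs hst z hz z' hz' => (hle s hs z z').trans ?_⟩
  rw [mul_assoc]
  exact mul_le_mul_of_nonneg_left (hL s hs hst z hz z' hz') hC

theorem add {h : ℝ → H → E} (hg : LocallyLipschitzFamily T g) (hh : LocallyLipschitzFamily T h) :
    LocallyLipschitzFamily T fun s z => g s z + h s z := by
  intro t ht x
  obtain ⟨L, r, hr, hL⟩ := hg t ht x
  obtain ⟨L', r', hr', hL'⟩ := hh t ht x
  refine ⟨L + L', min r r', lt_min hr hr', fun s hs hst z hz z' hz' => ?_⟩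
  have h1 := hL s hs (hst.trans_le (min_le_left _ _)) z
    (Metric.ball_subset_ball (min_le_left _ _) hz) z'
    (Metric.ball_subset_ball (min_le_left _ _) hz')
  have h2 := hL' s hs (hst.trans_le (min_le_right _ _)) z
    (Metric.ball_subset_ball (min_le_right _ _) hz) z'
    (Metric.ball_subset_ball (min_le_right _ _) hz')
  rw [add_sub_add_comm, add_mul]
  exact norm_add_le_of_le h1 h2

/-- A uniform Lipschitz constant in a tube around a continuous curve. -/
theorem exists_tube (hg : LocallyLipschitzFamily T g) {y : ℝ → H}
    (hy : ContinuousOn y (Icc 0 T)) :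
    ∃ L r : ℝ, 0 ≤ L ∧ 0 < r ∧ ∀ s ∈ Icc 0 T, ∀ z ∈ Metric.ball (y s) r,
      ∀ z' ∈ Metric.ball (y s) r, ‖g s z - g s z'‖ ≤ L * ‖z - z'‖ := by
  suffices h : ∃ L r : ℝ, 0 ≤ L ∧ 0 < r ∧ ∀ s ∈ Icc 0 T, s ∈ Icc 0 T →
      ∀ z ∈ Metric.ball (y s) r, ∀ z' ∈ Metric.ball (y s) r,
        ‖g s z - g s z'‖ ≤ L * ‖z - z'‖ by
    obtain ⟨L, r, hL, hr, h⟩ := h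
    exact ⟨L, r, hL, hr, fun s hs => h s hs hs⟩
  refine isCompact_Icc.induction_on (p := fun V => ∃ L r : ℝ, 0 ≤ L ∧ 0 < r ∧
    ∀ s ∈ V, s ∈ Icc 0 T → ∀ z ∈ Metric.ball (y s) r, ∀ z' ∈ Metric.ball (y s) r,
      ‖g s z - g s z'‖ ≤ L * ‖z - z'‖) ⟨0, 1, le_rfl, one_pos, by simp⟩ ?_ ?_ ?_
  · rintro V W hVW ⟨L, r, hL, hr, h⟩
    exact ⟨L, r, hL, hr, fun s hs => h s (hVW hs)⟩
  · rintro V W ⟨L, r, hL, hr, h⟩ ⟨L', r', hL', hr', h'⟩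
    refine ⟨max L L', min r r', le_max_of_le_left hL, lt_min hr hr', ?_⟩
    rintro s (hs | hs) hsT z hz z' hz'
    · exact (h s hs hsT z (Metric.ball_subset_ball (min_le_left _ _) hz) z'
        (Metric.ball_subset_ball (min_le_left _ _) hz')).trans
        (mul_le_mul_of_nonneg_right (le_max_left _ _) (norm_nonneg _))
    · exact (h' s hs hsT z (Metric.ball_subset_ball (min_le_right _ _) hz) z'
        (Metric.ball_subset_ball (min_le_right _ _) hz')).trans
        (mul_le_mul_of_nonneg_right (le_max_right _ _) (norm_nonneg _))
  · intro t ht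
    obtain ⟨L, r, hr, h⟩ := hg t ht (y t)
    -- Half of `r` is spent on the motion of `y s` away from `y t`, the other half is the tube
    -- radius.
    refine ⟨{s | |s - t| < r ∧ y s ∈ Metric.ball (y t) (r / 2)}, ?_, max L 0, r / 2,
      le_max_right _ _, half_pos hr, fun s hs hsT z hz z' hz' => ?_⟩
    · exact inter_mem (mem_nhdsWithin_of_mem_nhds (Metric.ball_mem_nhds t hr))
        (hy t ht (Metric.ball_mem_nhds _ (half_pos hr)))
    · have hsub : Metric.ball (y s) (r / 2) ⊆ Metric.ball (y t) r := by
        refine Metric.ball_subset_ball' ?_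
        have := Metric.mem_ball.1 hs.2
        linarith
      exact (h s hsT hs.1 z (hsub hz) z' (hsub hz')).trans
        (mul_le_mul_of_nonneg_right (le_max_left _ _) (norm_nonneg _))

/-- The local Lipschitz bound is uniform in time, which upgrades continuity in time at a frozen
state to continuity along a moving one. -/
theorem continuousOn_comp (hg : LocallyLipschitzFamily T g)
    (hgt : ∀ x, ContinuousOn (fun t => g t x) (Icc 0 T)) {y : ℝ → H}
    (hy : ContinuousOn y (Icc 0 T)) : ContinuousOn (fun s => g s (y s)) (Icc 0 T) := by
  intro t ht
  obtain ⟨L, r, hr, h⟩ := hg t ht (y t)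
  have h1 : Tendsto (fun s => g s (y s) - g s (y t)) (𝓝[Icc 0 T] t) (𝓝 0) := by
    have h2 : Tendsto (fun s => L * ‖y s - y t‖) (𝓝[Icc 0 T] t) (𝓝 0) := by
      have := ((hy t ht).sub (continuousWithinAt_const (b := y t))).norm.const_mul L
      simpa [ContinuousWithinAt] using this
    refine squeeze_zero_norm' ?_ h2
    filter_upwards [self_mem_nhdsWithin, mem_nhdsWithin_of_mem_nhds (Metric.ball_mem_nhds t hr),
      hy t ht (Metric.ball_mem_nhds _ hr)] with s hs hst hys
    exact h s hs hst _ hys _ (Metric.mem_ball_self hr)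
  have h3 := h1.add (hgt (y t) t ht)
  simpa [ContinuousWithinAt] using h3

/-- The family is Lipschitz along any two continuous curves. -/
theorem exists_norm_sub_le (hg : LocallyLipschitzFamily T g)
    (hgt : ∀ x, ContinuousOn (fun t => g t x) (Icc 0 T)) {y z : ℝ → H}
    (hy : ContinuousOn y (Icc 0 T)) (hz : ContinuousOn z (Icc 0 T)) :
    ∃ L : ℝ, 0 ≤ L ∧ ∀ s ∈ Icc 0 T, ‖g s (y s) - g s (z s)‖ ≤ L * ‖y s - z s‖ := by
  obtain ⟨L, r, hL, hr, h⟩ := hg.exists_tube hy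
  obtain ⟨C, hC⟩ := isCompact_Icc.exists_bound_of_continuousOn
    ((hg.continuousOn_comp hgt hy).sub (hg.continuousOn_comp hgt hz))
  -- Where the curves are at least `r` apart, the bound `C` on the difference is itself at most `C /
  -- r` times their distance.
  refine ⟨max L (C / r), le_max_of_le_left hL, fun s hs => ?_⟩
  rcases lt_or_ge ‖y s - z s‖ r with hlt | hge
  · refine (h s hs _ (Metric.mem_ball_self hr) _ ?_).trans
      (mul_le_mul_of_nonneg_right (le_max_left _ _) (norm_nonneg _))
    rwa [Metric.mem_ball, dist_eq_norm, norm_sub_rev]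
  · have h1 := hC s hs
    have hC0 : 0 ≤ C := (norm_nonneg _).trans h1
    refine h1.trans ?_
    calc C = C / r * r := by field_simp
      _ ≤ max L (C / r) * ‖y s - z s‖ :=
        mul_le_mul (le_max_right _ _) hge hr.le (le_max_of_le_left hL)

variable [NormedSpace ℝ H] [NormedSpace ℝ E]

/-- The mean value inequality works only at interior times, where `g` is differentiable; continuity
in time carries the estimate to the endpoints. -/
theorem of_fderiv_bounded (hT : 0 < T)
    (hgt : ∀ x, ContinuousOn (fun t => g t x) (Icc 0 T))
    (hdiff : ∀ t ∈ Ioo 0 T, Differentiable ℝ (g t))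
    (hbdd : ∀ t ∈ Icc 0 T, ∀ x : H, ∃ M r : ℝ, 0 < r ∧
      ∀ s ∈ Ioo 0 T, |s - t| < r → ∀ z ∈ Metric.ball x r, ‖fderiv ℝ (g s) z‖ ≤ M) :
    LocallyLipschitzFamily T g := by
  intro t ht x
  obtain ⟨M, r, hr, hM⟩ := hbdd t ht x
  refine ⟨M, r, hr, fun s hs hst z hz z' hz' => ?_⟩
  have hs' : s ∈ closure (Ioo 0 T) := by rwa [closure_Ioo hT.ne]
  have : (𝓝[Ioo 0 T] s).NeBot := mem_closure_iff_nhdsWithin_neBot.1 hs'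
  have hlim : Tendsto (fun s => ‖g s z - g s z'‖) (𝓝[Ioo 0 T] s) (𝓝 ‖g s z - g s z'‖) :=
    (((hgt z s hs).sub (hgt z' s hs)).norm).mono Ioo_subset_Icc_self
  refine le_of_tendsto hlim ?_
  filter_upwards [self_mem_nhdsWithin, mem_nhdsWithin_of_mem_nhds
    (Metric.isOpen_ball.mem_nhds (show s ∈ Metric.ball t r from hst))] with σ hσ hσt
  exact (convex_ball x r).norm_image_sub_le_of_norm_fderiv_le
    (fun w _ => hdiff σ hσ w) (fun w hw => hM σ hσ hσt w hw) hz' hz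

theorem const_of_contDiff {l : H → E} (hl : ContDiff ℝ 1 l) :
    LocallyLipschitzFamily T fun _ => l := by
  intro t _ x
  obtain ⟨K, V, hV, hK⟩ := hl.contDiffAt.exists_lipschitzOnWith (x := x)
  obtain ⟨r, hr, hrV⟩ := Metric.mem_nhds_iff.1 hV
  refine ⟨K, r, hr, fun s _ _ z hz z' hz' => ?_⟩
  simpa [dist_eq_norm] using hK.dist_le_mul z (hrV hz) z' (hrV hz')

end LocallyLipschitzFamily

end LocallyLipschitzFamily

/-! ### Needle variations and the perturbed state. -/

namespace SAC

section Needle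

variable {U : Type*} [NormedAddCommGroup U] {u₁ : ℝ → U}

theorem needle_eq (u₁ : ℝ → U) (lam τ : ℝ) (v : U) (s : ℝ) :
    needle u₁ lam τ v s =
      u₁ s + (Icc (τ - lam / 2) (τ + lam / 2)).indicator (fun s => v - u₁ s) s := by
  by_cases hs : s ∈ Icc (τ - lam / 2) (τ + lam / 2)
  · simp only [needle, if_pos hs, indicator_of_mem hs, add_sub_cancel]
  · simp only [needle, if_neg hs, indicator_of_notMem hs, add_zero]

theorem aestronglyMeasurable_needle {μ : Measure ℝ} (hu₁ : AEStronglyMeasurable u₁ μ)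
    (lam τ : ℝ) (v : U) : AEStronglyMeasurable (needle u₁ lam τ v) μ := by
  rw [funext (needle_eq u₁ lam τ v)]
  exact hu₁.add ((aestronglyMeasurable_const.sub hu₁).indicator measurableSet_Icc)

theorem norm_needle_le {C : ℝ} {v : U} {s : ℝ} (hu₁ : ‖u₁ s‖ ≤ C) (hv : ‖v‖ ≤ C) (lam τ : ℝ) :
    ‖needle u₁ lam τ v s‖ ≤ C := by
  unfold needle
  split_ifs
  exacts [hv, hu₁]

theorem integral_indicator_needle_le {C t lam : ℝ} (hC : 0 ≤ C) (ht : 0 ≤ t) (hlam : 0 ≤ lam)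
    (τ : ℝ) : ∫ s in (0 : ℝ)..t, (Icc (τ - lam / 2) (τ + lam / 2)).indicator (fun _ => C) s ≤
      C * lam := by
  rw [intervalIntegral.integral_of_le ht, integral_indicator_const _ measurableSet_Icc,
    smul_eq_mul, mul_comm]
  refine mul_le_mul_of_nonneg_left ?_ hC
  calc (volume.restrict (Ioc 0 t)).real (Icc (τ - lam / 2) (τ + lam / 2))
      ≤ volume.real (Icc (τ - lam / 2) (τ + lam / 2)) :=
        ENNReal.toReal_mono (by simp) (Measure.restrict_apply_le _ _)
    _ = lam := by
      rw [Real.volume_real_Icc_of_le (by linarith)]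
      ring

theorem exists_norm_needle_le (hu₁ : ContinuousOn u₁ (Icc 0 T)) (lam τ : ℝ) (v : U) :
    ∃ C, ∀ s ∈ Icc 0 T, ‖needle u₁ lam τ v s‖ ≤ C := by
  obtain ⟨C, hC⟩ := isCompact_Icc.exists_bound_of_continuousOn hu₁
  exact ⟨max C ‖v‖, fun s hs =>
    norm_needle_le ((hC s hs).trans (le_max_left _ _)) (le_max_right _ _) lam τ⟩

end Needle

variable {H U : Type*} [NormedAddCommGroup H] [InnerProductSpace ℝ H]
  [NormedAddCommGroup U] [InnerProductSpace ℝ U]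
variable {S : C0Semigroup H} {f : ℝ → H → U →L[ℝ] H} {y₀ : H} {T : ℝ} {u u₁ : ℝ → U} {y z : ℝ → H}

/-- The difference of two solutions satisfies the integrated equation without forcing, so Grönwall
with `a = 0` kills it. The Lipschitz constant may depend on the two curves. -/
theorem IsMildSolution.eqOn [CompleteSpace H] (hf : LocallyLipschitzFamily T f)
    (hft : ∀ x, ContinuousOn (fun t => f t x) (Icc 0 T)) {C : ℝ} (hu : ∀ s ∈ Icc 0 T, ‖u s‖ ≤ C)
    (hy : IsMildSolution S f y₀ T u y) (hz : IsMildSolution S f y₀ T u z) :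
    EqOn z y (Icc 0 T) := by
  intro t ht
  have hC : 0 ≤ C := (norm_nonneg _).trans (hu t ht)
  obtain ⟨M, hM0, hM⟩ := S.exists_norm_le T
  obtain ⟨L, hL0, hL⟩ := hf.exists_norm_sub_le hft hz.1 hy.1
  have key := C0Semigroup.norm_le_of_eq_conv (S := S) (w := fun s => z s - y s)
    (G := fun s => f s (z s) (u s) - f s (y s) (u s)) (g := fun _ => 0) (a := 0) (L := L * C)
    hM0 hM (mul_nonneg hL0 hC) (hz.1.sub hy.1) (by simp) (by simp) le_rfl ?_ ?_ t ht
  · rw [mul_zero, zero_mul] at key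
    exact sub_eq_zero.1 (norm_le_zero_iff.1 key)
  · intro s hs
    rw [zero_add, ← sub_apply, mul_right_comm]
    exact ContinuousLinearMap.le_of_opNorm_le_of_le _ (hL s hs) (hu s hs)
  · intro s hs
    rw [← C0Semigroup.conv_sub (hz.2 s hs).1 (hy.2 s hs).1, (hz.2 s hs).2, (hy.2 s hs).2,
      add_sub_add_left_eq_sub]
    rfl

/-- For short needles there is a mild solution, at distance `O(lam)` from the reference one. -/
theorem exists_needle_perturbation [CompleteSpace H] (hf : LocallyLipschitzFamily T f)
    (hft : ∀ x, ContinuousOn (fun t => f t x) (Icc 0 T)) (hT : 0 ≤ T)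
    (hu₁ : ContinuousOn u₁ (Icc 0 T)) (hy : IsMildSolution S f y₀ T u₁ y) (τ : ℝ) (v : U) :
    ∃ K : ℝ, 0 ≤ K ∧ ∀ᶠ lam in 𝓝[>] (0 : ℝ), ∃ w : ℝ → H, ContinuousOn w (Icc 0 T) ∧
      (∀ t ∈ Icc 0 T, ‖w t‖ ≤ K * lam) ∧
      IsMildSolution S f y₀ T (needle u₁ lam τ v) (fun s => y s + w s) ∧
      ∀ t ∈ Icc 0 T, w t =
        S.conv (fun s => f s (y s + w s) (needle u₁ lam τ v s) - f s (y s) (u₁ s)) t := by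
  have h0T : (0 : ℝ) ∈ Icc 0 T := ⟨le_rfl, hT⟩
  obtain ⟨M, hM0, hM⟩ := S.exists_norm_le T
  obtain ⟨L, r, hL0, hr, hL⟩ := hf.exists_tube hy.1
  obtain ⟨C₁, hC₁⟩ := isCompact_Icc.exists_bound_of_continuousOn hu₁
  have hfy := hf.continuousOn_comp hft hy.1
  obtain ⟨Cf, hCf⟩ := isCompact_Icc.exists_bound_of_continuousOn hfy
  have hCf0 : 0 ≤ Cf := (norm_nonneg _).trans (hCf 0 h0T)
  set C := max C₁ ‖v‖
  have hC0 : 0 ≤ C := le_max_of_le_right (norm_nonneg _)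
  have hu₁C : ∀ s ∈ Icc 0 T, ‖u₁ s‖ ≤ C := fun s hs => (hC₁ s hs).trans (le_max_left _ _)
  have hnC : ∀ lam, ∀ s ∈ Icc 0 T, ‖needle u₁ lam τ v s‖ ≤ C := fun lam s hs =>
    norm_needle_le (hu₁C s hs) (le_max_right _ _) lam τ
  have hρ : 0 < r / 2 := half_pos hr
  have hball : ∀ s (x : H), y s + radialRetraction (r / 2) x ∈ Metric.ball (y s) r := by
    intro s x
    rw [Metric.mem_ball, dist_eq_norm, add_sub_cancel_left]
    exact (norm_radialRetraction_le hρ x).trans_lt (half_lt_self hr)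
  have hu₁m : AEStronglyMeasurable u₁ (volume.restrict (Icc 0 T)) :=
    hu₁.aestronglyMeasurable measurableSet_Icc
  have hfym : AEStronglyMeasurable (fun s => f s (y s) (u₁ s)) (volume.restrict (Icc 0 T)) :=
    (hfy.clm_apply hu₁).aestronglyMeasurable measurableSet_Icc
  -- This is the constant of `norm_le_of_eq_conv` for forcing of integral `Cf * (C + C) * lam` and
  -- Lipschitz constant `2 * L * C`, the `2` being that of the retraction.
  set K := M * (Cf * (C + C)) * Real.exp (M * (2 * L * C) * T)
  have hK0 : 0 ≤ K := by positivity
  refine ⟨K, hK0, ?_⟩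
  have hsmall : ∀ᶠ lam in 𝓝[>] (0 : ℝ), K * lam < r / 2 := by
    have : Tendsto (fun lam : ℝ => K * lam) (𝓝[>] 0) (𝓝 (K * 0)) :=
      (tendsto_id.const_mul K).mono_left nhdsWithin_le_nhds
    exact this.eventually (Iio_mem_nhds (by simpa using hρ))
  filter_upwards [hsmall, self_mem_nhdsWithin] with lam hlam hlam0
  replace hlam0 : 0 < lam := hlam0
  set ul := needle u₁ lam τ v with hul
  -- Truncating the deviation at `r / 2` keeps the argument of `f` in the tube, so `F` is bounded
  -- and globally Lipschitz.
  let F : ℝ → H → H := fun s x => f s (y s + radialRetraction (r / 2) x) (ul s) - f s (y s) (u₁ s)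
  have hFm : ∀ w : ℝ → H, ContinuousOn w (Icc 0 T) →
      AEStronglyMeasurable (fun s => F s (w s)) (volume.restrict (Icc 0 T)) := by
    intro w hw
    have h1 : ContinuousOn (fun s => f s (y s + radialRetraction (r / 2) (w s))) (Icc 0 T) :=
      hf.continuousOn_comp hft (hy.1.add ((continuous_radialRetraction hρ).comp_continuousOn hw))
    refine AEStronglyMeasurable.sub ?_ hfym
    exact AEStronglyMeasurable.apply_of_pointwise
      (fun h => (h1.clm_apply continuousOn_const).aestronglyMeasurable measurableSet_Icc)
      (aestronglyMeasurable_needle hu₁m lam τ v)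
  have hFlip : ∀ s ∈ Icc 0 T, ∀ x x', ‖F s x - F s x'‖ ≤ 2 * L * C * ‖x - x'‖ := by
    intro s hs x x'
    simp only [F, sub_sub_sub_cancel_right]
    rw [← sub_apply]
    have h1 : ‖f s (y s + radialRetraction (r / 2) x) - f s (y s + radialRetraction (r / 2) x')‖ ≤
        L * (2 * ‖x - x'‖) := by
      refine (hL s hs _ (hball s x) _ (hball s x')).trans (mul_le_mul_of_nonneg_left ?_ hL0)
      rw [add_sub_add_left_eq_sub]
      exact norm_radialRetraction_sub_le hρ x x'
    exact (ContinuousLinearMap.le_of_opNorm_le_of_le _ h1 (hnC lam s hs)).trans_eq (by ring)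
  have hF0 : ∀ s ∈ Icc 0 T, ‖F s 0‖ ≤
      (Icc (τ - lam / 2) (τ + lam / 2)).indicator (fun _ => Cf * (C + C)) s := by
    intro s hs
    simp only [F, radialRetraction_of_norm_le hρ (norm_zero.trans_le hρ.le : ‖(0 : H)‖ ≤ r / 2),
      add_zero]
    rw [← map_sub, hul, needle_eq, add_sub_cancel_left]
    by_cases hsI : s ∈ Icc (τ - lam / 2) (τ + lam / 2)
    · rw [indicator_of_mem hsI, indicator_of_mem hsI]
      exact ContinuousLinearMap.le_of_opNorm_le_of_le _ (hCf s hs)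
        (norm_sub_le_of_le (le_max_right _ _) (hu₁C s hs))
    · rw [indicator_of_notMem hsI, indicator_of_notMem hsI, map_zero, norm_zero]
  have hFg : ∀ s ∈ Icc 0 T, ∀ x, ‖F s x‖ ≤
      (Icc (τ - lam / 2) (τ + lam / 2)).indicator (fun _ => Cf * (C + C)) s +
        2 * L * C * ‖x‖ := by
    intro s hs x
    have h1 := hFlip s hs x 0
    rw [sub_zero] at h1
    calc ‖F s x‖ = ‖F s 0 + (F s x - F s 0)‖ := by rw [add_sub_cancel]
      _ ≤ _ := norm_add_le_of_le (hF0 s hs) h1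
  have hFb : ∀ s ∈ Icc 0 T, ∀ x, ‖F s x‖ ≤ (Cf + L * r) * C + Cf * C := by
    intro s hs x
    refine norm_sub_le_of_le (ContinuousLinearMap.le_of_opNorm_le_of_le _ ?_ (hnC lam s hs))
      (ContinuousLinearMap.le_of_opNorm_le_of_le _ (hCf s hs) (hu₁C s hs))
    have h1 := hL s hs _ (hball s x) _ (Metric.mem_ball_self hr)
    rw [add_sub_cancel_left] at h1
    have h2 := norm_radialRetraction_le hρ x
    calc _ = ‖f s (y s) + (f s (y s + radialRetraction (r / 2) x) - f s (y s))‖ := by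
          rw [add_sub_cancel]
      _ ≤ _ := norm_add_le_of_le (hCf s hs)
        (h1.trans (mul_le_mul_of_nonneg_left (h2.trans (half_le_self hr.le)) hL0))
  obtain ⟨w, hw, hweq⟩ := C0Semigroup.exists_eq_conv (S := S) hT
    (by positivity : 0 ≤ 2 * L * C) hFm hFlip hFb
  have hwK : ∀ t ∈ Icc 0 T, ‖w t‖ ≤ K * lam := by
    intro t ht
    refine (C0Semigroup.norm_le_of_eq_conv (L := 2 * L * C)
      (a := Cf * (C + C) * lam) hM0 hM (by positivity) hw ?_ ?_ (by positivity)
      (fun s hs => hFg s hs (w s)) hweq t ht).trans_eq (by ring)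
    · intro t _
      exact ⟨(integrable_const _).indicator measurableSet_Icc,
        (integrable_const _).indicator measurableSet_Icc⟩
    · exact fun t ht => integral_indicator_needle_le (by positivity) ht.1 hlam0.le τ
  -- Since `K * lam < r / 2`, the solution never meets the truncation and solves the original
  -- equation.
  have hFw : ∀ s ∈ Icc 0 T, F s (w s) = f s (y s + w s) (ul s) - f s (y s) (u₁ s) := by
    intro s hs
    simp only [F, radialRetraction_of_norm_le hρ ((hwK s hs).trans hlam.le)]
  have hwG : ∀ t ∈ Icc 0 T,
      w t = S.conv (fun s => f s (y s + w s) (ul s) - f s (y s) (u₁ s)) t := by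
    intro t ht
    rw [hweq t ht]
    refine intervalIntegral.integral_congr fun s hs => ?_
    rw [uIcc_of_le ht.1] at hs
    simp only [hFw s ⟨hs.1, hs.2.trans ht.2⟩]
  refine ⟨w, hw, hwK, ⟨hy.1.add hw, fun t ht => ?_⟩, hwG⟩
  obtain ⟨hyi, hyt⟩ := hy.2 t ht
  have hFi := C0Semigroup.intervalIntegrable_conv (S := S) hM (hFm w hw)
    (fun s hs => hFb s hs (w s)) ht
  have hsum : EqOn (fun s => S.toFun (t - s) (f s (y s) (u₁ s)) + S.toFun (t - s) (F s (w s)))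
      (fun s => S.toFun (t - s) (f s (y s + w s) (ul s))) (uIcc 0 t) := by
    intro s hs
    rw [uIcc_of_le ht.1] at hs
    simp only [hFw s ⟨hs.1, hs.2.trans ht.2⟩]
    rw [← map_add, add_sub_cancel]
  refine ⟨(hyi.add hFi).congr (hsum.mono uIoc_subset_uIcc), ?_⟩
  rw [← intervalIntegral.integral_congr hsum, intervalIntegral.integral_add hyi hFi, ← add_assoc,
    ← hyt]
  exact congrArg (y t + ·) (hweq t ht)

end SAC

/-! ### Duality with the adjoint equation. -/

theorem intervalIntegrable_of_norm_le {E : Type*} [NormedAddCommGroup E] {T C : ℝ} {g : ℝ → E}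
    (hT : 0 ≤ T) (hg : AEStronglyMeasurable g (volume.restrict (Ioo 0 T)))
    (hC : ∀ s ∈ Ioo 0 T, ‖g s‖ ≤ C) : IntervalIntegrable g volume 0 T := by
  rw [intervalIntegrable_iff_integrableOn_Ioo_of_le hT]
  exact (integrable_const C).mono' hg
    ((ae_restrict_iff' measurableSet_Ioo).2 (Eventually.of_forall hC))

namespace C0Semigroup

variable {H : Type*} [NormedAddCommGroup H] [InnerProductSpace ℝ H]
variable {S : C0Semigroup H} {T : ℝ}

/-- Duality between the integrated state equation and the mild adjoint equation. -/
theorem integral_apply_conv_eq [CompleteSpace H] {G : ℝ → H} {q p : ℝ → StrongDual ℝ H} {C Cq : ℝ}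
    (hT : 0 ≤ T)
    (hG : AEStronglyMeasurable G (volume.restrict (Icc 0 T))) (hC : ∀ s ∈ Icc 0 T, ‖G s‖ ≤ C)
    (hq : ∀ h, AEStronglyMeasurable (fun s => q s h) (volume.restrict (Ioo 0 T)))
    (hCq : ∀ s ∈ Ioo 0 T, ‖q s‖ ≤ Cq) (hpc : ContinuousOn p (Icc 0 T))
    (hp : ∀ t ∈ Icc 0 T,
      IntervalIntegrable (fun s => (q s).comp (S.toFun (s - t))) volume t T ∧
      p t = (p T).comp (S.toFun (T - t)) + ∫ s in t..T, (q s).comp (S.toFun (s - t))) :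
    ∫ s in (0 : ℝ)..T, q s (S.conv G s) =
      (∫ s in (0 : ℝ)..T, p s (G s)) - p T (S.conv G T) := by
  have hTT : T ∈ Icc 0 T := ⟨hT, le_rfl⟩
  obtain ⟨M, hM0, hM⟩ := S.exists_norm_le T
  obtain ⟨Cp, hCp⟩ := isCompact_Icc.exists_bound_of_continuousOn hpc
  have hGo : AEStronglyMeasurable G (volume.restrict (Ioo 0 T)) := hG.mono_set Ioo_subset_Icc_self
  set μ : Measure ℝ := volume.restrict (Ioo 0 T) with hμ
  -- The kernel lives on the triangle `r ≤ s`. Integrating first in `r` produces the convolution,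
  -- first in `s` the integral term of the adjoint equation.
  let Φ : ℝ → ℝ → ℝ := fun s r => (Iic s).indicator (fun r => q s (S.extend (s - r) (G r))) r
  have hΦm : AEStronglyMeasurable (Function.uncurry Φ) (μ.prod μ) := by
    have h1 : AEStronglyMeasurable (fun x : ℝ × ℝ => S.extend (x.1 - x.2) (G x.2)) (μ.prod μ) :=
      AEStronglyMeasurable.apply_of_pointwise
        (fun h => ((S.continuous_extend_apply h).comp
          (continuous_fst.sub continuous_snd)).aestronglyMeasurable) hGo.comp_snd
    have h2 : AEStronglyMeasurable
        (fun x : ℝ × ℝ => q x.1 (S.extend (x.1 - x.2) (G x.2))) (μ.prod μ) :=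
      AEStronglyMeasurable.apply_of_pointwise (fun h => (hq h).comp_fst) h1
    exact h2.indicator (measurableSet_le measurable_snd measurable_fst)
  have hΦb : ∀ᵐ x ∂(μ.prod μ), ‖Function.uncurry Φ x‖ ≤ Cq * (M * C) := by
    rw [hμ, Measure.prod_restrict, ae_restrict_iff' (measurableSet_Ioo.prod measurableSet_Ioo)]
    refine Eventually.of_forall fun x hx => ?_
    refine (norm_indicator_le_norm_self (s := Iic x.1)
      (fun r => q x.1 (S.extend (x.1 - r) (G r))) x.2).trans ?_
    refine (q x.1).le_of_opNorm_le_of_le (hCq _ hx.1) ?_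
    exact (S.extend (x.1 - x.2)).le_of_opNorm_le_of_le (hM _ (by linarith [hx.1.2, hx.2.1]))
      (hC _ (Ioo_subset_Icc_self hx.2))
  have hΦi : Integrable (Function.uncurry Φ) (μ.prod μ) :=
    (integrable_const _).mono' hΦm hΦb
  have hleft : ∀ s ∈ Ioo 0 T, ∫ r, Φ s r ∂μ = q s (S.conv G s) := by
    intro s hs
    rw [conv_eq hs.1.le, intervalIntegral.integral_of_le hs.1.le,
      ← (q s).integral_comp_comm ((intervalIntegrable_iff_integrableOn_Ioc_of_le hs.1.le).1
        (intervalIntegrable_extend hM hG hC (Ioo_subset_Icc_self hs))),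
      hμ, setIntegral_indicator measurableSet_Iic]
    congr 2
    ext r
    exact ⟨fun h => ⟨h.1.1, h.2⟩, fun h => ⟨⟨h.1, h.2.trans_lt hs.2⟩, h.2⟩⟩
  have hright : ∀ r ∈ Ioo 0 T,
      ∫ s, Φ s r ∂μ = p r (G r) - p T (S.extend (T - r) (G r)) := by
    intro r hr
    obtain ⟨hi, he⟩ := hp r (Ioo_subset_Icc_self hr)
    have h1 : ∀ s, Φ s r = (Ici r).indicator (fun s => q s (S.extend (s - r) (G r))) s := by
      intro s
      by_cases h : r ≤ s
      · rw [indicator_of_mem (show s ∈ Ici r from h)]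
        exact indicator_of_mem (show r ∈ Iic s from h) _
      · rw [indicator_of_notMem (show s ∉ Ici r from h)]
        exact indicator_of_notMem (show r ∉ Iic s from h) _
    have h2 : ∫ s, Φ s r ∂μ = ∫ s in Ioc r T, q s (S.extend (s - r) (G r)) := by
      simp only [h1]
      rw [hμ, setIntegral_indicator measurableSet_Ici, integral_Ioc_eq_integral_Ioo,
        ← integral_Ico_eq_integral_Ioo]
      congr 2
      ext s
      exact ⟨fun h => ⟨h.2, h.1.2⟩, fun h => ⟨⟨hr.1.trans_le h.1, h.2⟩, h.1⟩⟩
    rw [h2, he, S.extend_of_nonneg (sub_nonneg.2 hr.2.le), add_apply,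
      ContinuousLinearMap.comp_apply, add_sub_cancel_left,
      ContinuousLinearMap.intervalIntegral_apply hi, intervalIntegral.integral_of_le hr.2.le]
    refine setIntegral_congr_fun measurableSet_Ioc fun s hs => ?_
    simp only [S.extend_of_nonneg (sub_nonneg.2 hs.1.le), ContinuousLinearMap.comp_apply]
  have hpG : IntervalIntegrable (fun r => p r (G r)) volume 0 T := by
    refine intervalIntegrable_of_norm_le hT (C := Cp * C) ?_ fun s hs =>
      (p s).le_of_opNorm_le_of_le (hCp s (Ioo_subset_Icc_self hs)) (hC s (Ioo_subset_Icc_self hs))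
    exact AEStronglyMeasurable.apply_of_pointwise (fun h => ((hpc.clm_apply
      continuousOn_const).mono Ioo_subset_Icc_self).aestronglyMeasurable measurableSet_Ioo) hGo
  have hSG := intervalIntegrable_extend hM hG hC hTT
  have hpS : IntervalIntegrable (fun r => p T (S.extend (T - r) (G r))) volume 0 T :=
    ⟨(p T).integrable_comp hSG.1, (p T).integrable_comp hSG.2⟩
  have hswap := integral_integral_swap hΦi
  rw [conv_eq hT, ← (p T).intervalIntegral_comp_comm hSG, ← intervalIntegral.integral_sub hpG hpS]
  simp only [intervalIntegral.integral_of_le hT, integral_Ioc_eq_integral_Ioo]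
  rw [← setIntegral_congr_fun measurableSet_Ioo hleft, hswap]
  exact setIntegral_congr_fun measurableSet_Ioo hright

end C0Semigroup

/-! ### First-order remainders along the perturbed state. -/

section Remainder

variable {H : Type*} [NormedAddCommGroup H] [NormedSpace ℝ H]

theorem HasFDerivAt.tendsto_remainder_div {g : H → ℝ} {g' : StrongDual ℝ H} {x : H}
    (hg : HasFDerivAt g g' x) {w : ℝ → H} {K : ℝ}
    (hw : ∀ᶠ lam in 𝓝[>] (0 : ℝ), ‖w lam‖ ≤ K * lam) :
    Tendsto (fun lam => (g (x + w lam) - g x - g' (w lam)) / lam) (𝓝[>] 0) (𝓝 0) := by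
  have hO : w =O[𝓝[>] (0 : ℝ)] fun lam => lam := by
    refine Asymptotics.IsBigO.of_bound K ?_
    filter_upwards [hw, self_mem_nhdsWithin] with lam h h0
    rwa [Real.norm_of_nonneg (le_of_lt h0)]
  have hw0 : Tendsto w (𝓝[>] 0) (𝓝 0) :=
    hO.trans_tendsto (tendsto_id.mono_left nhdsWithin_le_nhds)
  exact (((hasFDerivAt_iff_isLittleO_nhds_zero.1 hg).comp_tendsto hw0).trans_isBigO
    hO).tendsto_div_nhds_zero

variable {T : ℝ} {g : ℝ → H → ℝ} {q : ℝ → StrongDual ℝ H} {y : ℝ → H}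

/-- A derivative is bounded by the Lipschitz constant near its base point, and the tube provides one
constant for all times. -/
theorem LocallyLipschitzFamily.exists_norm_le_of_hasFDerivAt (hg : LocallyLipschitzFamily T g)
    (hy : ContinuousOn y (Icc 0 T)) (hq : ∀ s ∈ Ioo 0 T, HasFDerivAt (g s) (q s) (y s)) :
    ∃ C, ∀ s ∈ Ioo 0 T, ‖q s‖ ≤ C := by
  obtain ⟨L, r, hL0, hr, hL⟩ := hg.exists_tube hy
  refine ⟨L, fun s hs => (hq s hs).le_of_lip' hL0 ?_⟩
  filter_upwards [Metric.ball_mem_nhds _ hr] with z hz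
  exact hL s (Ioo_subset_Icc_self hs) z hz _ (Metric.mem_ball_self hr)

/-- The directional derivative is a pointwise limit of difference quotients that are continuous in
time. -/
theorem LocallyLipschitzFamily.aestronglyMeasurable_of_hasFDerivAt
    (hg : LocallyLipschitzFamily T g) (hgt : ∀ x, ContinuousOn (fun t => g t x) (Icc 0 T))
    (hy : ContinuousOn y (Icc 0 T)) (hq : ∀ s ∈ Ioo 0 T, HasFDerivAt (g s) (q s) (y s)) (h : H) :
    AEStronglyMeasurable (fun s => q s h) (volume.restrict (Ioo 0 T)) := by
  refine aestronglyMeasurable_of_tendsto_ae (u := atTop)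
    (f := fun (n : ℕ) s => (n : ℝ) • (g s (y s + (n : ℝ)⁻¹ • h) - g s (y s))) (fun n => ?_)
    ((ae_restrict_iff' measurableSet_Ioo).2 (Eventually.of_forall fun s hs =>
      ((hq s hs).lim_real h).comp tendsto_natCast_atTop_atTop))
  refine ContinuousOn.aestronglyMeasurable ?_ measurableSet_Ioo
  have h1 := (hg.continuousOn_comp hgt (hy.add (continuousOn_const (c := (n : ℝ)⁻¹ • h)))).sub
    (hg.continuousOn_comp hgt hy)
  exact (h1.const_smul (n : ℝ)).mono Ioo_subset_Icc_self

theorem LocallyLipschitzFamily.intervalIntegrable_fderiv_apply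
    (hg : LocallyLipschitzFamily T g) (hgt : ∀ x, ContinuousOn (fun t => g t x) (Icc 0 T))
    (hT : 0 ≤ T) (hy : ContinuousOn y (Icc 0 T))
    (hq : ∀ s ∈ Ioo 0 T, HasFDerivAt (g s) (q s) (y s)) {w : ℝ → H}
    (hw : ContinuousOn w (Icc 0 T)) : IntervalIntegrable (fun s => q s (w s)) volume 0 T := by
  obtain ⟨C, hC⟩ := hg.exists_norm_le_of_hasFDerivAt hy hq
  obtain ⟨C', hC'⟩ := isCompact_Icc.exists_bound_of_continuousOn hw
  refine intervalIntegrable_of_norm_le hT ?_ fun s hs =>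
    (q s).le_of_opNorm_le_of_le (hC s hs) (hC' s (Ioo_subset_Icc_self hs))
  exact AEStronglyMeasurable.apply_of_pointwise
    (hg.aestronglyMeasurable_of_hasFDerivAt hgt hy hq)
    ((hw.mono Ioo_subset_Icc_self).aestronglyMeasurable measurableSet_Ioo)

theorem LocallyLipschitzFamily.intervalIntegrable_remainder
    (hg : LocallyLipschitzFamily T g) (hgt : ∀ x, ContinuousOn (fun t => g t x) (Icc 0 T))
    (hT : 0 ≤ T) (hy : ContinuousOn y (Icc 0 T))
    (hq : ∀ s ∈ Ioo 0 T, HasFDerivAt (g s) (q s) (y s)) {w : ℝ → H}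
    (hw : ContinuousOn w (Icc 0 T)) :
    IntervalIntegrable (fun s => g s (y s + w s) - g s (y s) - q s (w s)) volume 0 T :=
  (((hg.continuousOn_comp hgt (hy.add hw)).sub
    (hg.continuousOn_comp hgt hy)).intervalIntegrable_of_Icc hT).sub
    (hg.intervalIntegrable_fderiv_apply hgt hT hy hq hw)

/-- Differentiability gives the limit at each time only; the tube's Lipschitz constant and the bound
on `q` dominate the quotients uniformly. -/
theorem LocallyLipschitzFamily.tendsto_integral_remainder_div
    (hg : LocallyLipschitzFamily T g) (hgt : ∀ x, ContinuousOn (fun t => g t x) (Icc 0 T))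
    (hT : 0 ≤ T) (hy : ContinuousOn y (Icc 0 T))
    (hq : ∀ s ∈ Ioo 0 T, HasFDerivAt (g s) (q s) (y s)) {w : ℝ → ℝ → H} {K : ℝ}
    (hw : ∀ᶠ lam in 𝓝[>] (0 : ℝ), ContinuousOn (w lam) (Icc 0 T) ∧
      ∀ s ∈ Icc 0 T, ‖w lam s‖ ≤ K * lam) :
    Tendsto (fun lam => (∫ s in (0 : ℝ)..T,
      (g s (y s + w lam s) - g s (y s) - q s (w lam s))) / lam) (𝓝[>] 0) (𝓝 0) := by
  obtain ⟨L, r, hL0, hr, hL⟩ := hg.exists_tube hy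
  obtain ⟨C, hC⟩ := hg.exists_norm_le_of_hasFDerivAt hy hq
  have hsmall : ∀ᶠ lam in 𝓝[>] (0 : ℝ), K * lam < r := by
    have : Tendsto (fun lam : ℝ => K * lam) (𝓝[>] 0) (𝓝 (K * 0)) :=
      (tendsto_id.const_mul K).mono_left nhdsWithin_le_nhds
    exact this.eventually (Iio_mem_nhds (by simpa using hr))
  have key : Tendsto (fun lam => ∫ s in Ioo 0 T,
      (g s (y s + w lam s) - g s (y s) - q s (w lam s)) / lam) (𝓝[>] 0)
      (𝓝 (∫ _ in Ioo 0 T, (0 : ℝ))) := by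
    refine tendsto_integral_filter_of_dominated_convergence (fun _ => L * K + C * K) ?_ ?_
      (integrable_const _) ?_
    · filter_upwards [hw] with lam hlam
      have := hg.intervalIntegrable_remainder hgt hT hy hq hlam.1
      rw [intervalIntegrable_iff_integrableOn_Ioo_of_le hT] at this
      exact (Integrable.div_const this lam).aestronglyMeasurable
    · filter_upwards [hw, hsmall, self_mem_nhdsWithin] with lam hlam hr' h0
      replace h0 : 0 < lam := h0
      refine (ae_restrict_iff' measurableSet_Ioo).2 (Eventually.of_forall fun s hs => ?_)
      have hs' := Ioo_subset_Icc_self hs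
      have hws := hlam.2 s hs'
      rw [norm_div, Real.norm_of_nonneg h0.le, div_le_iff₀ h0, add_mul, mul_assoc, mul_assoc]
      refine norm_sub_le_of_le ?_ ((q s).le_of_opNorm_le_of_le (hC s hs) hws)
      refine (hL s hs' _ ?_ _ (Metric.mem_ball_self hr)).trans ?_
      · rw [Metric.mem_ball, dist_eq_norm, add_sub_cancel_left]
        exact hws.trans_lt hr'
      · rw [add_sub_cancel_left]
        exact mul_le_mul_of_nonneg_left hws hL0
    · refine (ae_restrict_iff' measurableSet_Ioo).2 (Eventually.of_forall fun s hs => ?_)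
      exact (hq s hs).tendsto_remainder_div (hw.mono fun lam h => h.2 s (Ioo_subset_Icc_self hs))
  simp only [integral_zero, integral_div] at key
  simpa only [intervalIntegral.integral_of_le hT, integral_Ioc_eq_integral_Ioo] using key

end Remainder

/-! ### Averaging over the needle. -/

/-- Averages over shrinking intervals of functions that converge uniformly to a continuous one. -/
theorem tendsto_average_needle {T τ B : ℝ} (hτ : τ ∈ Ioo 0 T) {k : ℝ → ℝ → ℝ} {k₀ : ℝ → ℝ}
    (hk₀ : ContinuousOn k₀ (Icc 0 T))
    (hk : ∀ᶠ lam in 𝓝[>] (0 : ℝ), ContinuousOn (k lam) (Icc 0 T) ∧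
      ∀ s ∈ Icc 0 T, |k lam s - k₀ s| ≤ B * lam) :
    Tendsto (fun lam => (∫ s in (0 : ℝ)..T,
      (Icc (τ - lam / 2) (τ + lam / 2)).indicator (k lam) s) / lam) (𝓝[>] 0) (𝓝 (k₀ τ)) := by
  rw [Metric.tendsto_nhds]
  intro ε hε
  have hε2 : 0 < ε / 2 := half_pos hε
  have hε4 : 0 < ε / 4 := by positivity
  have hsmall : ∀ᶠ lam in 𝓝[>] (0 : ℝ), B * lam < ε / 4 := by
    have : Tendsto (fun lam : ℝ => B * lam) (𝓝[>] 0) (𝓝 (B * 0)) :=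
      (tendsto_id.const_mul B).mono_left nhdsWithin_le_nhds
    exact this.eventually (Iio_mem_nhds (by simpa using hε4))
  have hcont : ContinuousAt k₀ τ := hk₀.continuousAt (Icc_mem_nhds hτ.1 hτ.2)
  -- Within `δ` of `τ` the oscillation of `k₀` costs `ε / 4` and replacing `k lam` by `k₀` another
  -- `ε / 4`; `δ` also keeps the needle inside `[0,T]`.
  obtain ⟨δ, hδ, hδk⟩ := Metric.mem_nhds_iff.1
    (inter_mem (hcont (Metric.ball_mem_nhds _ hε4)) (Icc_mem_nhds hτ.1 hτ.2))
  filter_upwards [hk, hsmall, self_mem_nhdsWithin,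
    mem_nhdsWithin_of_mem_nhds (Iio_mem_nhds hδ)] with lam hlam hB h0 hlamδ
  replace h0 : 0 < lam := h0
  replace hlamδ : lam < δ := hlamδ
  have hle : τ - lam / 2 ≤ τ + lam / 2 := by linarith
  have hI : ∀ s ∈ Icc (τ - lam / 2) (τ + lam / 2), |k₀ s - k₀ τ| < ε / 4 ∧ s ∈ Icc 0 T := by
    intro s hs
    have := hδk (show s ∈ Metric.ball τ δ by
      rw [Metric.mem_ball, Real.dist_eq, abs_lt]
      constructor <;> linarith [hs.1, hs.2])
    exact ⟨this.1, this.2⟩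
  have h1 : ∫ s in (0 : ℝ)..T, (Icc (τ - lam / 2) (τ + lam / 2)).indicator (k lam) s =
      ∫ s in (τ - lam / 2)..(τ + lam / 2), k lam s := by
    rw [intervalIntegral.integral_of_le (hτ.1.trans hτ.2).le, intervalIntegral.integral_of_le hle,
      ← integral_Icc_eq_integral_Ioc, setIntegral_indicator measurableSet_Icc,
      inter_eq_right.2 fun s hs => (hI s hs).2, integral_Icc_eq_integral_Ioc]
  have hint : IntervalIntegrable (k lam) volume (τ - lam / 2) (τ + lam / 2) :=
    ContinuousOn.intervalIntegrable_of_Icc hle (hlam.1.mono fun s hs => (hI s hs).2)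
  have h2 : ‖∫ s in (τ - lam / 2)..(τ + lam / 2), (k lam s - k₀ τ)‖ ≤
      ε / 2 * |τ + lam / 2 - (τ - lam / 2)| := by
    refine intervalIntegral.norm_integral_le_of_norm_le_const fun s hs => ?_
    rw [uIoc_of_le hle] at hs
    obtain ⟨h3, h4⟩ := hI s (Ioc_subset_Icc_self hs)
    have h5 := hlam.2 s h4
    rw [Real.norm_eq_abs, abs_le]
    rw [abs_lt] at h3
    rw [abs_le] at h5
    constructor <;> linarith [h3.1, h3.2, h5.1, h5.2]
  have hlen : τ + lam / 2 - (τ - lam / 2) = lam := by ring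
  rw [intervalIntegral.integral_sub hint intervalIntegrable_const,
    intervalIntegral.integral_const, hlen, abs_of_pos h0, smul_eq_mul] at h2
  rw [h1, Real.dist_eq, div_sub' h0.ne', abs_div, abs_of_pos h0, div_lt_iff₀ h0]
  exact h2.trans_lt (mul_lt_mul_of_pos_right (half_lt_self hε) h0)

/-! ### The mode insertion gradient. -/

namespace SAC

variable {H U : Type*} [NormedAddCommGroup H] [InnerProductSpace ℝ H]
  [NormedAddCommGroup U] [InnerProductSpace ℝ U]
variable {S : C0Semigroup H} {f : ℝ → H → U →L[ℝ] H} {l₁ m : H → ℝ} {y₀ : H} {T : ℝ}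
  {u u₁ : ℝ → U} {y : ℝ → H} {p : ℝ → StrongDual ℝ H}

/-- Uniqueness on `[0,T]` makes the solution chosen inside `stageCost` immaterial. -/
theorem stageCost_eq (hT : 0 ≤ T) (hy : IsMildSolution S f y₀ T u y)
    (huniq : ∀ z, IsMildSolution S f y₀ T u z → EqOn z y (Icc 0 T)) :
    stageCost S f l₁ m y₀ T u = (∫ s in (0 : ℝ)..T, l₁ (y s)) + m (y T) := by
  have h : ∃ y, IsMildSolution S f y₀ T u y := ⟨y, hy⟩
  have he := huniq _ h.choose_spec
  rw [stageCost, dif_pos h, he ⟨hT, le_rfl⟩]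
  congr 1
  refine intervalIntegral.integral_congr fun s hs => ?_
  rw [uIcc_of_le hT] at hs
  simp only [he hs]

/-- The control Hamiltonian `⟨p(s), f(s,z) u(s)⟩ + l₁(z)`. -/
def hamiltonian (f : ℝ → H → U →L[ℝ] H) (l₁ : H → ℝ) (u : ℝ → U) (p : ℝ → StrongDual ℝ H)
    (s : ℝ) (z : H) : ℝ :=
  p s (f s z (u s)) + l₁ z

theorem locallyLipschitzFamily_hamiltonian (hf : LocallyLipschitzFamily T f)
    (hl₁ : ContDiff ℝ 1 l₁) (hu : ContinuousOn u (Icc 0 T)) (hp : ContinuousOn p (Icc 0 T)) :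
    LocallyLipschitzFamily T (hamiltonian f l₁ u p) := by
  obtain ⟨Cu, hCu⟩ := isCompact_Icc.exists_bound_of_continuousOn hu
  obtain ⟨Cp, hCp⟩ := isCompact_Icc.exists_bound_of_continuousOn hp
  refine LocallyLipschitzFamily.add (hf.of_le (C := |Cp| * |Cu|) (by positivity) ?_)
    (.const_of_contDiff hl₁)
  intro s hs z z'
  rw [← map_sub, ← sub_apply, mul_assoc, mul_comm |Cu|]
  refine (p s).le_of_opNorm_le_of_le ((hCp s hs).trans (le_abs_self _)) ?_
  exact ContinuousLinearMap.le_of_opNorm_le_of_le _ le_rfl ((hCu s hs).trans (le_abs_self _))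

theorem continuousOn_hamiltonian (hft : ∀ x, ContinuousOn (fun t => f t x) (Icc 0 T))
    (hu : ContinuousOn u (Icc 0 T)) (hp : ContinuousOn p (Icc 0 T)) (x : H) :
    ContinuousOn (fun t => hamiltonian f l₁ u p t x) (Icc 0 T) :=
  (hp.clm_apply ((hft x).clm_apply hu)).add continuousOn_const

theorem hasFDerivAt_hamiltonian {s : ℝ} (hf : DifferentiableAt ℝ (f s) (y s))
    (hl₁ : DifferentiableAt ℝ l₁ (y s)) :
    HasFDerivAt (hamiltonian f l₁ u p s) (adjointSource f l₁ u y p s) (y s) := by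
  have h1 : DifferentiableAt ℝ (fun x => f s x (u s)) (y s) :=
    hf.clm_apply (differentiableAt_const _)
  exact ((p s).hasFDerivAt.comp (y s) h1.hasFDerivAt).add hl₁.hasFDerivAt

theorem continuousOn_P (hf : LocallyLipschitzFamily T f)
    (hft : ∀ x, ContinuousOn (fun t => f t x) (Icc 0 T)) (hy : ContinuousOn y (Icc 0 T))
    (hp : ContinuousOn p (Icc 0 T)) : ContinuousOn (P f y p) (Icc 0 T) :=
  hp.clm_comp (hf.continuousOn_comp hft hy)

variable [CompleteSpace H]

/-- Exact expansion of the cost increment caused by a control variation. -/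
theorem cost_sub_eq (hT : 0 ≤ T) (hf : LocallyLipschitzFamily T f)
    (hft : ∀ x, ContinuousOn (fun t => f t x) (Icc 0 T))
    (hfd : ∀ t ∈ Ioo 0 T, Differentiable ℝ (f t))
    (hl₁ : ContDiff ℝ 1 l₁) (hu₁ : ContinuousOn u₁ (Icc 0 T))
    (hy : ContinuousOn y (Icc 0 T)) (hp : IsMildAdjoint S f l₁ m T u₁ y p)
    {w : ℝ → H} (hw : ContinuousOn w (Icc 0 T)) (lam τ : ℝ) (v : U)
    (hweq : ∀ t ∈ Icc 0 T, w t =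
      S.conv (fun s => f s (y s + w s) (needle u₁ lam τ v s) - f s (y s) (u₁ s)) t) :
    ((∫ s in (0 : ℝ)..T, l₁ (y s + w s)) + m (y T + w T)) -
      ((∫ s in (0 : ℝ)..T, l₁ (y s)) + m (y T)) =
    (∫ s in (0 : ℝ)..T, (hamiltonian f l₁ u₁ p s (y s + w s) - hamiltonian f l₁ u₁ p s (y s) -
        adjointSource f l₁ u₁ y p s (w s))) +
      (∫ s in (0 : ℝ)..T, (Icc (τ - lam / 2) (τ + lam / 2)).indicator
        (fun s => p s (f s (y s + w s) (v - u₁ s))) s) +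
      (m (y T + w T) - m (y T) - fderiv ℝ m (y T) (w T)) := by
  set q := adjointSource f l₁ u₁ y p with hq
  set ul := needle u₁ lam τ v with hul
  set G : ℝ → H := fun s => f s (y s + w s) (ul s) - f s (y s) (u₁ s) with hGdef
  have hham := locallyLipschitzFamily_hamiltonian hf hl₁ hu₁ hp.1
  have hhamt := continuousOn_hamiltonian (l₁ := l₁) hft hu₁ hp.1
  have hqd : ∀ s ∈ Ioo 0 T, HasFDerivAt (hamiltonian f l₁ u₁ p s) (q s) (y s) := fun s hs =>
    hasFDerivAt_hamiltonian (hfd s hs _) (hl₁.differentiable one_ne_zero _)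
  have hyw := hy.add hw
  have hfy := hf.continuousOn_comp hft hy
  have hfyw := hf.continuousOn_comp hft hyw
  have hulm : AEStronglyMeasurable ul (volume.restrict (Icc 0 T)) :=
    aestronglyMeasurable_needle (hu₁.aestronglyMeasurable measurableSet_Icc) lam τ v
  have hGm : AEStronglyMeasurable G (volume.restrict (Icc 0 T)) :=
    (AEStronglyMeasurable.apply_of_pointwise (fun h => (hfyw.clm_apply
      continuousOn_const).aestronglyMeasurable measurableSet_Icc) hulm).sub
      ((hfy.clm_apply hu₁).aestronglyMeasurable measurableSet_Icc)
  obtain ⟨Cu, hCu⟩ := exists_norm_needle_le hu₁ lam τ v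
  obtain ⟨Cf, hCf⟩ := isCompact_Icc.exists_bound_of_continuousOn hfyw
  obtain ⟨C₀, hC₀⟩ := isCompact_Icc.exists_bound_of_continuousOn (hfy.clm_apply hu₁)
  have hGb : ∀ s ∈ Icc 0 T, ‖G s‖ ≤ Cf * Cu + C₀ := fun s hs =>
    norm_sub_le_of_le (ContinuousLinearMap.le_of_opNorm_le_of_le _ (hCf s hs) (hCu s hs)) (hC₀ s hs)
  obtain ⟨Cq, hCq⟩ := hham.exists_norm_le_of_hasFDerivAt hy hqd
  have hdual := C0Semigroup.integral_apply_conv_eq hT hGm hGb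
    (hham.aestronglyMeasurable_of_hasFDerivAt hhamt hy hqd) hCq hp.1 hp.2.2
  -- The terminal condition turns the boundary term of the duality into the linear part of the
  -- increment of `m`.
  rw [← hweq T ⟨hT, le_rfl⟩, hp.2.1] at hdual
  have hdual' : ∫ s in (0 : ℝ)..T, q s (w s) =
      (∫ s in (0 : ℝ)..T, p s (G s)) - fderiv ℝ m (y T) (w T) := by
    rw [← hdual]
    refine intervalIntegral.integral_congr fun s hs => ?_
    rw [uIcc_of_le hT] at hs
    simp only [hweq s hs]
  have hrem := hham.intervalIntegrable_remainder hhamt hT hy hqd hw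
  have hqw := hham.intervalIntegrable_fderiv_apply hhamt hT hy hqd hw
  have hpG : IntervalIntegrable (fun s => p s (G s)) volume 0 T := by
    obtain ⟨Cp, hCp⟩ := isCompact_Icc.exists_bound_of_continuousOn hp.1
    refine intervalIntegrable_of_norm_le hT (C := Cp * (Cf * Cu + C₀)) ?_ fun s hs =>
      (p s).le_of_opNorm_le_of_le (hCp s (Ioo_subset_Icc_self hs)) (hGb s (Ioo_subset_Icc_self hs))
    exact AEStronglyMeasurable.apply_of_pointwise (fun h => ((hp.1.clm_apply
      continuousOn_const).mono Ioo_subset_Icc_self).aestronglyMeasurable measurableSet_Ioo)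
      (hGm.mono_set Ioo_subset_Icc_self)
  have hk : IntervalIntegrable ((Icc (τ - lam / 2) (τ + lam / 2)).indicator
      fun s => p s (f s (y s + w s) (v - u₁ s))) volume 0 T := by
    have := (hp.1.clm_apply (hfyw.clm_apply
      (continuousOn_const.sub hu₁ : ContinuousOn (fun s => v - u₁ s) _))).intervalIntegrable_of_Icc
      (μ := volume) hT
    exact ⟨this.1.indicator measurableSet_Icc, this.2.indicator measurableSet_Icc⟩
  have hl₁y : IntervalIntegrable (fun s => l₁ (y s)) volume 0 T :=
    (hl₁.continuous.comp_continuousOn hy).intervalIntegrable_of_Icc hT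
  have hl₁yw : IntervalIntegrable (fun s => l₁ (y s + w s)) volume 0 T :=
    (hl₁.continuous.comp_continuousOn hyw).intervalIntegrable_of_Icc hT
  -- The increment of `l₁` is that of the Hamiltonian minus that of the control term; the last
  -- bracket integrates to `-m_y(y(T)) w(T)` by duality.
  have hpt : ∀ s, l₁ (y s + w s) - l₁ (y s) =
      (hamiltonian f l₁ u₁ p s (y s + w s) - hamiltonian f l₁ u₁ p s (y s) - q s (w s)) +
        (Icc (τ - lam / 2) (τ + lam / 2)).indicator
          (fun s => p s (f s (y s + w s) (v - u₁ s))) s + (q s (w s) - p s (G s)) := by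
    intro s
    have h1 : (Icc (τ - lam / 2) (τ + lam / 2)).indicator
        (fun s => p s (f s (y s + w s) (v - u₁ s))) s =
        p s (f s (y s + w s) (ul s)) - p s (f s (y s + w s) (u₁ s)) := by
      rw [hul, needle_eq, map_add, map_add, add_sub_cancel_left]
      by_cases hs : s ∈ Icc (τ - lam / 2) (τ + lam / 2)
      · simp only [indicator_of_mem hs]
      · simp only [indicator_of_notMem hs, map_zero]
    rw [h1]
    simp only [hGdef, hamiltonian, map_sub]
    ring
  have hint : (∫ s in (0 : ℝ)..T, l₁ (y s + w s)) - ∫ s in (0 : ℝ)..T, l₁ (y s) =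
      (∫ s in (0 : ℝ)..T, (hamiltonian f l₁ u₁ p s (y s + w s) - hamiltonian f l₁ u₁ p s (y s) -
        q s (w s))) +
      (∫ s in (0 : ℝ)..T, (Icc (τ - lam / 2) (τ + lam / 2)).indicator
        (fun s => p s (f s (y s + w s) (v - u₁ s))) s) - fderiv ℝ m (y T) (w T) := by
    rw [← intervalIntegral.integral_sub hl₁yw hl₁y]
    simp only [hpt]
    rw [intervalIntegral.integral_add (hrem.add hk) (hqw.sub hpG),
      intervalIntegral.integral_add hrem hk, intervalIntegral.integral_sub hqw hpG, hdual']
    ring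
  linarith

/-- The mode insertion gradient is `P(τ)(v - u₁(τ))`. -/
theorem hasModeInsertionGradient (hf : LocallyLipschitzFamily T f)
    (hft : ∀ x, ContinuousOn (fun t => f t x) (Icc 0 T))
    (hfd : ∀ t ∈ Ioo 0 T, Differentiable ℝ (f t))
    (hl₁ : ContDiff ℝ 1 l₁) (hm : ContDiff ℝ 1 m) (hu₁ : ContinuousOn u₁ (Icc 0 T))
    (hy : IsMildSolution S f y₀ T u₁ y) (hp : IsMildAdjoint S f l₁ m T u₁ y p)
    {τ : ℝ} (hτ : τ ∈ Ioo 0 T) (v : U) :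
    HasModeInsertionGradient S f l₁ m y₀ T u₁ τ v (P f y p τ (v - u₁ τ)) := by
  have hT : 0 ≤ T := (hτ.1.trans hτ.2).le
  have hTT : T ∈ Icc 0 T := ⟨hT, le_rfl⟩
  obtain ⟨K, hK0, hK⟩ := exists_needle_perturbation hf hft hT hu₁ hy τ v
  -- One family `lam ↦ w lam` is fixed, with the perturbation properties for all small `lam`.
  obtain ⟨w, hw⟩ := hK.choice
  have hham := locallyLipschitzFamily_hamiltonian hf hl₁ hu₁ hp.1
  have hhamt := continuousOn_hamiltonian (l₁ := l₁) hft hu₁ hp.1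
  have h1 := hham.tendsto_integral_remainder_div hhamt hT hy.1
    (fun s hs => hasFDerivAt_hamiltonian (hfd s hs _) (hl₁.differentiable one_ne_zero _))
    (hw.mono fun lam h => ⟨h.1, h.2.1⟩)
  have h3 := ((hm.differentiable one_ne_zero (y T)).hasFDerivAt).tendsto_remainder_div
    (hw.mono fun lam h => h.2.1 T hTT)
  have hvu : ContinuousOn (fun s => v - u₁ s) (Icc 0 T) := continuousOn_const.sub hu₁
  have h2 : Tendsto (fun lam => (∫ s in (0 : ℝ)..T, (Icc (τ - lam / 2) (τ + lam / 2)).indicator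
      (fun s => p s (f s (y s + w lam s) (v - u₁ s))) s) / lam) (𝓝[>] 0)
      (𝓝 (P f y p τ (v - u₁ τ))) := by
    obtain ⟨L, r, hL0, hr, hL⟩ := hf.exists_tube hy.1
    obtain ⟨Cp, hCp⟩ := isCompact_Icc.exists_bound_of_continuousOn hp.1
    obtain ⟨Cv, hCv⟩ := isCompact_Icc.exists_bound_of_continuousOn hvu
    have hsmall : ∀ᶠ lam in 𝓝[>] (0 : ℝ), K * lam < r := by
      have : Tendsto (fun lam : ℝ => K * lam) (𝓝[>] 0) (𝓝 (K * 0)) :=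
        (tendsto_id.const_mul K).mono_left nhdsWithin_le_nhds
      exact this.eventually (Iio_mem_nhds (by simpa using hr))
    refine tendsto_average_needle (k := fun lam s => p s (f s (y s + w lam s) (v - u₁ s)))
      (k₀ := fun s => p s (f s (y s) (v - u₁ s))) (B := Cp * (L * K * Cv)) hτ
      (hp.1.clm_apply ((hf.continuousOn_comp hft hy.1).clm_apply hvu)) ?_
    filter_upwards [hw, hsmall] with lam hlam hr'
    refine ⟨hp.1.clm_apply ((hf.continuousOn_comp hft (hy.1.add hlam.1)).clm_apply hvu),
      fun s hs => ?_⟩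
    have hws := hlam.2.1 s hs
    have hfs : ‖f s (y s + w lam s) - f s (y s)‖ ≤ L * (K * lam) := by
      refine (hL s hs _ ?_ _ (Metric.mem_ball_self hr)).trans ?_
      · rw [Metric.mem_ball, dist_eq_norm, add_sub_cancel_left]
        exact hws.trans_lt hr'
      · rw [add_sub_cancel_left]
        exact mul_le_mul_of_nonneg_left hws hL0
    rw [← map_sub, ← sub_apply, ← Real.norm_eq_abs]
    refine ((p s).le_of_opNorm_le_of_le (hCp s hs)
      (ContinuousLinearMap.le_of_opNorm_le_of_le _ hfs (hCv s hs))).trans_eq ?_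
    ring
  have h := (h1.add h2).add h3
  rw [zero_add, add_zero] at h
  refine h.congr' ?_
  filter_upwards [hw] with lam hlam
  obtain ⟨C, hC⟩ := isCompact_Icc.exists_bound_of_continuousOn hu₁
  obtain ⟨C', hC'⟩ := exists_norm_needle_le hu₁ lam τ v
  rw [stageCost_eq hT hlam.2.2.1 fun z hz => hlam.2.2.1.eqOn hf hft hC' hz,
    stageCost_eq hT hy fun z hz => hy.eqOn hf hft hC hz,
    cost_sub_eq hT hf hft hfd hl₁ hu₁ hy.1 hp hlam.1 lam τ v hlam.2.2.2, add_div, add_div]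

end SAC

/-! ### The quadratic subproblem. -/

namespace SAC

section Quadratic

variable {H U : Type*} [NormedAddCommGroup H] [InnerProductSpace ℝ H]
  [NormedAddCommGroup U] [InnerProductSpace ℝ U] [CompleteSpace U]
  {f : ℝ → H → U →L[ℝ] H} {y : ℝ → H} {p : ℝ → StrongDual ℝ H} {R : U →L[ℝ] U}

theorem inner_gram (hR : IsSelfAdjoint R) (t : ℝ) (v w : U) :
    inner ℝ (gram f y p R t v) w = P f y p t v * P f y p t w + inner ℝ (R v) w := by
  rw [gram, hR.adjoint_eq, add_apply, inner_add_left, ContinuousLinearMap.comp_apply,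
    ContinuousLinearMap.adjoint_inner_left]
  simp [mul_comm]

/-- Lax–Milgram: `P^*P` is nonnegative, so the coercivity of `R` passes to the sum. -/
theorem isInvertible_gram (hR : IsSelfAdjoint R) {γ : ℝ} (hγ : 0 < γ)
    (hRc : ∀ v : U, γ * ‖v‖ ^ 2 ≤ inner ℝ (R v) v) (t : ℝ) :
    (gram f y p R t).IsInvertible := by
  obtain ⟨e, he⟩ := ContinuousLinearMap.isUnit_of_forall_le_norm_inner_map (gram f y p R t)
    (c := ⟨γ, hγ.le⟩) hγ fun x => by
      refine le_trans ?_ (Real.le_norm_self _)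
      rw [inner_gram hR]
      change ‖x‖ ^ 2 * γ ≤ _
      linarith [hRc x, mul_self_nonneg (P f y p t x)]
  exact ⟨ContinuousLinearEquiv.ofUnit e, he⟩

/-- Completing the square in the objective of the subproblem. -/
theorem l₂_eq_add (hR : IsSelfAdjoint R) {γ : ℝ} (hγ : 0 < γ)
    (hRc : ∀ v : U, γ * ‖v‖ ^ 2 ≤ inner ℝ (R v) v) (u₁ : ℝ → U) (α τ : ℝ) (v : U) :
    l₂ (fun v => P f y p τ (v - u₁ τ)) α R v =
      l₂ (fun v => P f y p τ (v - u₁ τ)) α R (control f y p R u₁ α τ) +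
        1 / 2 * inner ℝ (gram f y p R τ (v - control f y p R u₁ α τ))
          (v - control f y p R u₁ α τ) := by
  set c := control f y p R u₁ α τ with hc
  set h := v - c with hh
  have hv : v = c + h := by rw [hh, add_sub_cancel]
  have hgc : gram f y p R τ c = ContinuousLinearMap.adjoint (P f y p τ) (P f y p τ (u₁ τ)) +
      ContinuousLinearMap.adjoint (P f y p τ) α :=
    (isInvertible_gram hR hγ hRc τ).self_apply_inverse _
  have h1 : inner ℝ (gram f y p R τ c) h = (P f y p τ (u₁ τ) + α) * P f y p τ h := by
    rw [hgc, inner_add_left, ContinuousLinearMap.adjoint_inner_left,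
      ContinuousLinearMap.adjoint_inner_left]
    simp only [RCLike.inner_apply, conj_trivial]
    ring
  rw [inner_gram hR] at h1
  have h2 : inner ℝ h (R c) = inner ℝ (R c) h := real_inner_comm _ _
  have h3 : inner ℝ c (R h) = inner ℝ (R c) h := by
    conv_rhs => rw [← hR.adjoint_eq, ContinuousLinearMap.adjoint_inner_left]
  have h4 : inner ℝ h (R h) = inner ℝ (R h) h := real_inner_comm _ _
  rw [inner_gram hR, hv]
  simp only [l₂, map_sub, map_add, inner_add_left, inner_add_right, h2, h3, h4]
  -- The terms linear in `h` are exactly the normal equation `h1` tested with `h`.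
  linear_combination h1

/-- The excess over the value at `control` is half the `gram` form of the deviation, at least `γ /
2` times its squared norm. -/
theorem isMinOn_control (hR : IsSelfAdjoint R) {γ : ℝ} (hγ : 0 < γ)
    (hRc : ∀ v : U, γ * ‖v‖ ^ 2 ≤ inner ℝ (R v) v) (u₁ : ℝ → U) (α τ : ℝ) :
    IsMinOn (l₂ (fun v => P f y p τ (v - u₁ τ)) α R) univ (control f y p R u₁ α τ) ∧
    ∀ w : U, IsMinOn (l₂ (fun v => P f y p τ (v - u₁ τ)) α R) univ w →
      w = control f y p R u₁ α τ := by
  have hpos : ∀ h : U, γ * ‖h‖ ^ 2 ≤ inner ℝ (gram f y p R τ h) h := fun h => by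
    rw [inner_gram hR]
    linarith [hRc h, mul_self_nonneg (P f y p τ h)]
  refine ⟨fun v _ => ?_, fun w hw => ?_⟩
  · have h1 := hpos (v - control f y p R u₁ α τ)
    have h2 : 0 ≤ γ * ‖v - control f y p R u₁ α τ‖ ^ 2 := by positivity
    rw [mem_ofPred_eq, l₂_eq_add hR hγ hRc u₁ α τ v]
    linarith
  · have h0 := hw (mem_univ (control f y p R u₁ α τ))
    rw [mem_ofPred_eq, l₂_eq_add hR hγ hRc u₁ α τ w] at h0
    have h1 := hpos (w - control f y p R u₁ α τ)
    have h2 : ‖w - control f y p R u₁ α τ‖ ^ 2 ≤ 0 := by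
      by_contra! h
      linarith [mul_pos hγ h]
    have h3 : ‖w - control f y p R u₁ α τ‖ = 0 :=
      pow_eq_zero_iff two_ne_zero |>.1 (le_antisymm h2 (sq_nonneg _))
    exact sub_eq_zero.1 (norm_eq_zero.1 h3)

end Quadratic

end SAC

theorem theorem2p1 {H U : Type*}
    [NormedAddCommGroup H] [InnerProductSpace ℝ H] [CompleteSpace H]
    [NormedAddCommGroup U] [InnerProductSpace ℝ U] [CompleteSpace U]
    (T : ℝ) (hT : 0 < T)
    (S : C0Semigroup H) (A : H →ₗ.[ℝ] H)
    (hA_dense : Dense (A.domain : Set H)) (hA : SAC.IsGenerator S A)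
    (l₁ m : H → ℝ) (hl₁ : ContDiff ℝ 1 l₁) (hm : ContDiff ℝ 1 m)
    (f : ℝ → H → U →L[ℝ] H)
    (hf_time : ∀ x : H, ContinuousOn (fun t => f t x) (Set.Icc 0 T))
    (hf_diff : ∀ t ∈ Set.Ioo 0 T, ContDiff ℝ 1 (f t))
    (hf_bdd : ∀ t ∈ Set.Icc 0 T, ∀ x : H, ∃ M r : ℝ, 0 < r ∧
      ∀ s ∈ Set.Ioo 0 T, |s - t| < r → ∀ z ∈ Metric.ball x r, ‖fderiv ℝ (f s) z‖ ≤ M)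
    (R : U →L[ℝ] U) (hR : IsSelfAdjoint R)
    (γ : ℝ) (hγ : 0 < γ) (hR_coercive : ∀ v : U, γ * ‖v‖ ^ 2 ≤ inner ℝ (R v) v)
    (α : ℝ) (y₀ : H)
    (u₁ : ℝ → U) (hu₁ : ContinuousOn u₁ (Set.Icc 0 T))
    (y : ℝ → H) (hy : SAC.IsMildSolution S f y₀ T u₁ y)
    (p : ℝ → StrongDual ℝ H) (hp : SAC.IsMildAdjoint S f l₁ m T u₁ y p) :
    ContinuousOn (SAC.P f y p) (Set.Icc 0 T) ∧
    (∀ t ∈ Set.Icc 0 T, (SAC.gram f y p R t).IsInvertible) ∧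
    SAC.HasUniqueState S f y₀ T u₁ ∧
    (∀ τ ∈ Set.Ioo 0 T, ∀ v : U,
      ∀ᶠ lam in nhdsWithin (0 : ℝ) (Set.Ioi 0),
        SAC.HasUniqueState S f y₀ T (SAC.needle u₁ lam τ v)) ∧
    ∀ τ ∈ Set.Icc 0 T, ∃ dJ : U → ℝ,
      (∀ v : U, SAC.HasSensitivity S f l₁ m y₀ T u₁ τ v (dJ v)) ∧
      IsMinOn (SAC.l₂ dJ α R) Set.univ (SAC.control f y p R u₁ α τ) ∧
      ∀ w : U, IsMinOn (SAC.l₂ dJ α R) Set.univ w → w = SAC.control f y p R u₁ α τ := by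
  have hfd : ∀ t ∈ Set.Ioo 0 T, Differentiable ℝ (f t) := fun t ht =>
    (hf_diff t ht).differentiable one_ne_zero
  have hf : LocallyLipschitzFamily T f := .of_fderiv_bounded hT hf_time hfd hf_bdd
  have hP := SAC.continuousOn_P hf hf_time hy.1 hp.1
  have hgrad : ∀ τ ∈ Set.Ioo 0 T, ∀ v, SAC.HasModeInsertionGradient S f l₁ m y₀ T u₁ τ v
      (SAC.P f y p τ (v - u₁ τ)) := fun τ hτ v =>
    SAC.hasModeInsertionGradient hf hf_time hfd hl₁ hm hu₁ hy hp hτ v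
  refine ⟨hP, fun t _ => SAC.isInvertible_gram hR hγ hR_coercive t, ?_, ?_, ?_⟩
  · obtain ⟨C, hC⟩ := isCompact_Icc.exists_bound_of_continuousOn hu₁
    exact ⟨y, hy, fun z hz => hy.eqOn hf hf_time hC hz⟩
  · intro τ _ v
    obtain ⟨K, _, hK⟩ := SAC.exists_needle_perturbation hf hf_time hT.le hu₁ hy τ v
    filter_upwards [hK] with lam hlam
    obtain ⟨w, _, _, hw, _⟩ := hlam
    obtain ⟨C, hC⟩ := SAC.exists_norm_needle_le hu₁ lam τ v
    exact ⟨_, hw, fun z hz => hw.eqOn hf hf_time hC hz⟩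
  · intro τ hτ
    refine ⟨fun v => SAC.P f y p τ (v - u₁ τ), fun v => ?_,
      SAC.isMinOn_control hR hγ hR_coercive u₁ α τ⟩
    by_cases hτ' : τ ∈ Set.Ioo 0 T
    · exact Or.inl ⟨hτ', hgrad τ hτ' v⟩
    -- At an endpoint the interior gradients converge because `P` and `u₁` are continuous up to the
    -- boundary, so the same formula persists.
    · refine Or.inr ⟨?_, fun σ => SAC.P f y p σ (v - u₁ σ), fun σ hσ => hgrad σ hσ v, ?_⟩
      · by_contra! h
        exact hτ' ⟨lt_of_le_of_ne hτ.1 h.1.symm, lt_of_le_of_ne hτ.2 h.2⟩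
      · exact ((hP.clm_apply (continuousOn_const.sub hu₁)) τ hτ).mono Set.Ioo_subset_Icc_self
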